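/- **Notation.** For an integer $l\ge 1$ let $\mathcal B_l$ be the level $l$ perfect crystal of $U_q'(G_2^{(1)})$ (index set $I=\{0,1,2\}$, weights taken modulo the null root) in its coordinate realization: the set of $b=(x_1,x_2,x_3,\bar x_3,\bar x_2,\bar x_1)\in(\frac13\mathbb Z_{\ge 0})^6$ with $3x_3\equiv 3\bar x_3 \pmod 2$, $s(b):=x_1+x_2+\frac{x_3+\bar x_3}{2}+\bar x_2+\bar x_1\le l$ and $x_1,\bar x_1,x_2-x_3,\bar x_3-\bar x_2\in\mathbb Z$. Put $z_1=\bar x_1-x_1$, $z_2=\bar x_2-\bar x_3$, $z_3=x_3-x_2$, $z_4=\frac{\bar x_3-x_3}{2}$, $(a)_+=\max(a,0)$, and let $A=(a_1,\dots,a_6)=(0,\ z_1,\ z_1+z_2,\ z_1+z_2+3z_4,\ z_1+z_2+z_3+3z_4,\ 2z_1+z_2+z_3+3z_4)$. Then $\varepsilon_0=l-s(b)+\max A-a_6$, $\varphi_0=l-s(b)+\max A$, $\varepsilon_1=\bar x_1+(\bar x_3-\bar x_2+(x_2-x_3)_+)_+$, $\varphi_1=x_1+(x_3-x_2+(\bar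 x_2-\bar x_3)_+)_+$, $\varepsilon_2=3\bar x_2+\frac32(x_3-\bar x_3)_+$, $\varphi_2=3x_2+\frac32(\bar x_3-x_3)_+$, and $\langle h_i,\mathrm{wt}(b)\rangle=\varphi_i-\varepsilon_i$. The operators add the following vectors to $b$ (the result is read as $0$ if it is not in $\mathcal B_l$). $\tilde f_2$: $(0,-\frac13,\frac23,0,0,0)$ if $z_4\le 0$, $(0,0,0,-\frac23,\frac13,0)$ if $z_4>0$. $\tilde e_2$: $(0,0,0,\frac23,-\frac13,0)$ if $z_4\ge 0$, $(0,\frac13,-\frac23,0,0,0)$ if $z_4<0$. $\tilde f_1$: $(-1,1,0,0,0,0)$ if $(z_2)_+\le -z_3$; $(0,0,-1,1,0,0)$ if $z_2\le 0<z_3$; $(0,0,0,0,-1,1)$ if $z_2>(-z_3)_+$. $\tilde e_1$: $(0,0,0,0,1,-1)$ if $z_2\ge(-z_3)_+$; $(0,0,1,-1,0,0)$ if $z_2<0\le z_3$; $(1,-1,0,0,0,0)$ if $(z_2)_+<-z_3$. $\tilde f_0$: let $j$ be the first index with $a_j=\max A$; the vector is $(1,0,0,0,0,0)$ for $j=1$,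 $(0,0,1,1,0,-1)$ for $j=2$, $(0,0,2,0,-1,0)$ for $j=3$, $(1,0,-1,-1,0,0)$ for $j=5$, $(0,0,0,0,0,-1)$ for $j=6$, and for $j=4$ it is $(0,\frac13,\frac43,-\frac23,-\frac23,0)$ if $z_4=\frac13$, $(0,\frac23,\frac23,-\frac43,-\frac13,0)$ if $z_4=\frac23$, and $(0,1,0,-2,0,0)$ otherwise. $\tilde e_0$: let $j$ be the last index with $a_j=\max A$; the vector is $(-1,0,0,0,0,0)$ for $j=1$, $(0,0,-1,-1,0,1)$ for $j=2$, $(0,-1,0,2,0,0)$ for $j=4$, $(-1,0,1,1,0,0)$ for $j=5$, $(0,0,0,0,0,1)$ for $j=6$, and for $j=3$ it is $(0,-\frac23,-\frac23,\frac43,\frac13,0)$ if $z_4=-\frac13$, $(0,-\frac13,-\frac43,\frac23,\frac23,0)$ if $z_4=-\frac23$, and $(0,0,-2,0,1,0)$ otherwise. On tensor products, $\mathrm{wt}(b\otimes b')=\mathrm{wt}(b)+\mathrm{wt}(b')$, $\varepsilon_i(b\otimes b')=\max(\varepsilon_i(b),\varepsilon_i(b')-\langle h_i,\mathrm{wt}(b)\rangle)$,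 $\varphi_i(b\otimes b')=\max(\varphi_i(b'),\varphi_i(b)+\langle h_i,\mathrm{wt}(b')\rangle)$; $\tilde e_i$ acts on the left factor if $\varphi_i(b)\ge\varepsilon_i(b')$ and on the right one otherwise, and $\tilde f_i$ acts on the left factor if $\varphi_i(b)>\varepsilon_i(b')$ and on the right one otherwise. For $k\ge 1$ let $\mathcal R:\mathcal B_k\otimes\mathcal B_1\to\mathcal B_1\otimes\mathcal B_k$ be the (unique) isomorphism of crystals and write $\mathcal R(b\otimes b')=\tilde b'\otimes\tilde b$. Let $u_k=(k,0,0,0,0,0)\in\mathcal B_k$, and let $H:\mathcal B_k\otimes\mathcal B_1\to\mathbb Z$ be the energy function normalized by $H(u_k\otimes u_1)=0$: whenever $\tilde e_i(b\otimes b')\ne 0$, $H(\tilde e_i(b\otimes b'))-H(b\otimes b')$ equals $1$ if $i=0$, $\varphi_0(b)\ge\varepsilon_0(b')$ and $\varphi_0(\tilde b')\ge\varepsilon_0(\tilde b)$; equals $-1$ if $i=0$, $\varphi_0(b)<\varepsilon_0(b')$ and $\varphi_0(\tilde b')<\varepsilon_0(\tilde b)$; and equals $0$ otherwise. For a state $p=b_1\otimes\cdots\otimes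 b_L\in\mathcal B_1^{\otimes L}$ put $u^{(0)}=u_k$ and $\mathcal R(u^{(i)}\otimes b_{i+1})=\tilde b_{i+1}\otimes u^{(i+1)}$ for $0\le i<L$. The state energy is $E_k(p)=-\sum_{i=0}^{L-1}H(u^{(i)}\otimes b_{i+1})$. If $u^{(L)}=u_k$, the time evolution is $T_k(p)=\tilde b_1\otimes\cdots\otimes\tilde b_L$; that is, $T_k(p)\otimes u_k=\mathcal R_{L,L+1}\cdots\mathcal R_{12}(u_k\otimes p)$. Write $1=(1,0,0,0,0,0)$, $2=(0,1,0,0,0,0)$, $2_1=(0,\frac23,\frac23,0,0,0)$, $2_2=(0,\frac13,\frac43,0,0,0)$, $3=(0,0,2,0,0,0)$ in $\mathcal B_1$. For $l\ge 1$, a soliton $[l]$ of length $l$ is one of $3^{\otimes m}\otimes 2^{\otimes(l-m)}$ ($0\le m\le l$), $3^{\otimes m}\otimes 2_1\otimes 2^{\otimes(l-m-1)}$, $3^{\otimes m}\otimes 2_2\otimes 2^{\otimes(l-m-1)}$ ($0\le m\le l-1$), and a one-soliton state of length $l$ is a state $p=1^{\otimes a}\otimes[l]\otimes 1^{\otimes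 r}$ with $a,r\ge 0$. **Proposition.** Let $k,l\ge 1$ and let $p=1^{\otimes a}\otimes[l]\otimes1^{\otimes r}$ be a one-soliton state of length $l$. Then 1. $E_k(p)=\min(k,l)$; 2. if $r\ge\min(k,l)$ (so that there is room for the shift), then $u^{(L)}=u_k$, so that $T_k(p)$ is defined, and $T_k(p)=1^{\otimes(a+\min(k,l))}\otimes[l]\otimes1^{\otimes(r-\min(k,l))}$ with the same $[l]$; that is, $T_k(p)$ is the rightward shift of $p$ by $\min(k,l)$ lattice steps. -/

import Mathlib

/-! # The soliton cellular automaton of type `G₂⁽¹⁾`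

All crystals below are `U_q'(G₂⁽¹⁾)`-crystals with index set `I = {0, 1, 2}` (`Fin 3`); weights are
taken modulo the null root, so a weight is given by its pairings with the coroots `h₀, h₁, h₂`.
In an `Option`-valued operator, `none` is the extra element `0` of the crystal. -/

namespace G2SCA

/-- The operations of a crystal on the set `B`: the pairings `wt b i = ⟨h_i, wt b⟩`, the Kashiwara
operators `e i`, `f i` and the functions `ε i`, `φ i`. (All values of `wt`, `ε`, `φ` in the crystals
below are integers; they are written in `ℚ` because the coordinates are rational.) -/
structure CrystalOps (B : Type) where
  wt : B → Fin 3 → ℚ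
  e : Fin 3 → B → Option B
  f : Fin 3 → B → Option B
  ε : Fin 3 → B → ℚ
  φ : Fin 3 → B → ℚ

/-- The tensor product of two crystals; `(b₁, b₂)` stands for `b₁ ⊗ b₂`. -/
def CrystalOps.tensor {B₁ B₂ : Type} (C₁ : CrystalOps B₁) (C₂ : CrystalOps B₂) :
    CrystalOps (B₁ × B₂) where
  wt b i := C₁.wt b.1 i + C₂.wt b.2 i
  e i b := if C₂.ε i b.2 ≤ C₁.φ i b.1 then (C₁.e i b.1).map (fun c => (c, b.2))
    else (C₂.e i b.2).map (fun c => (b.1, c))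
  f i b := if C₂.ε i b.2 < C₁.φ i b.1 then (C₁.f i b.1).map (fun c => (c, b.2))
    else (C₂.f i b.2).map (fun c => (b.1, c))
  ε i b := max (C₁.ε i b.1) (C₂.ε i b.2 - C₁.wt b.1 i)
  φ i b := max (C₂.φ i b.2) (C₁.φ i b.1 + C₂.wt b.2 i)

/-- A bijection `Ψ` (extended by `Ψ 0 = 0`) is an isomorphism of crystals. -/
def IsCrystalIso {B₁ B₂ : Type} (C₁ : CrystalOps B₁) (C₂ : CrystalOps B₂) (Ψ : B₁ ≃ B₂) : Prop :=
  (∀ b i, C₂.wt (Ψ b) i = C₁.wt b i ∧ C₂.ε i (Ψ b) = C₁.ε i b ∧ C₂.φ i (Ψ b) = C₁.φ i b) ∧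
  (∀ b b' i, C₁.f i b = some b' →
    C₂.f i (Ψ b) = some (Ψ b') ∧ C₂.e i (Ψ b') = some (Ψ b))

/-- A sextuple `(x₁, x₂, x₃, x̄₃, x̄₂, x̄₁)`, with `yⱼ` for `x̄ⱼ`. -/
@[ext] structure Coord where
  x₁ : ℚ
  x₂ : ℚ
  x₃ : ℚ
  y₃ : ℚ
  y₂ : ℚ
  y₁ : ℚ

/-- Membership in `ℤ_{≥ 0} / 3`. -/
def IsThird (q : ℚ) : Prop := ∃ n : ℕ, q = n / 3

/-- Membership in `ℤ`. -/
def IsInt (q : ℚ) : Prop := ∃ n : ℤ, q = n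

namespace Coord

/-- `s(b)`, the sum bounded by `l` in the definition of `𝓑_l`. -/
def s (b : Coord) : ℚ := b.x₁ + b.x₂ + (b.x₃ + b.y₃) / 2 + b.y₂ + b.y₁

/-- `b` is an element of `𝓑_l`. -/
structure Mem (l : ℕ) (b : Coord) : Prop where
  hx₁ : IsThird b.x₁
  hx₂ : IsThird b.x₂
  hx₃ : IsThird b.x₃
  hy₃ : IsThird b.y₃
  hy₂ : IsThird b.y₂
  hy₁ : IsThird b.y₁
  parity : ∃ n : ℤ, 3 * b.x₃ - 3 * b.y₃ = 2 * n
  le : b.s ≤ l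
  int₁ : IsInt b.x₁
  int₂ : IsInt b.y₁
  int₃ : IsInt (b.x₂ - b.x₃)
  int₄ : IsInt (b.y₃ - b.y₂)

def z₁ (b : Coord) : ℚ := b.y₁ - b.x₁
def z₂ (b : Coord) : ℚ := b.y₂ - b.y₃
def z₃ (b : Coord) : ℚ := b.x₃ - b.x₂
def z₄ (b : Coord) : ℚ := (b.y₃ - b.x₃) / 2

/-- The maximum of the set `A`. -/
def maxA (b : Coord) : ℚ :=
  max 0 (max b.z₁ (max (b.z₁ + b.z₂) (max (b.z₁ + b.z₂ + 3 * b.z₄)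
    (max (b.z₁ + b.z₂ + b.z₃ + 3 * b.z₄) (2 * b.z₁ + b.z₂ + b.z₃ + 3 * b.z₄)))))

/-! The conditions `(F₁), …, (F₆)` for `f̃₀` and `(E₁), …, (E₆)` for `ẽ₀`. Each family is mutually
exclusive and exhaustive: `(F_i)` (resp. `(E_i)`) says that the maximum of `A` is attained for the
first (resp. last) time at the `i`-th entry of the list in `maxA`. -/

def F₁ (b : Coord) : Prop := b.z₁ + b.z₂ + b.z₃ + 3 * b.z₄ ≤ 0 ∧ b.z₁ + b.z₂ + 3 * b.z₄ ≤ 0 ∧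
  b.z₁ + b.z₂ ≤ 0 ∧ b.z₁ ≤ 0
def F₂ (b : Coord) : Prop := b.z₁ + b.z₂ + b.z₃ + 3 * b.z₄ ≤ 0 ∧ b.z₂ + 3 * b.z₄ ≤ 0 ∧
  b.z₂ ≤ 0 ∧ 0 < b.z₁
def F₃ (b : Coord) : Prop := b.z₁ + b.z₃ + 3 * b.z₄ ≤ 0 ∧ b.z₃ + 3 * b.z₄ ≤ 0 ∧ b.z₄ ≤ 0 ∧
  0 < b.z₂ ∧ 0 < b.z₁ + b.z₂
def F₄ (b : Coord) : Prop := 0 < b.z₁ + b.z₂ + 3 * b.z₄ ∧ 0 < b.z₂ + 3 * b.z₄ ∧ 0 < b.z₄ ∧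
  b.z₃ ≤ 0 ∧ b.z₁ + b.z₃ ≤ 0
def F₅ (b : Coord) : Prop := 0 < b.z₁ + b.z₂ + b.z₃ + 3 * b.z₄ ∧ 0 < b.z₃ + 3 * b.z₄ ∧ 0 < b.z₃ ∧
  b.z₁ ≤ 0
def F₆ (b : Coord) : Prop := 0 < b.z₁ + b.z₂ + b.z₃ + 3 * b.z₄ ∧ 0 < b.z₁ + b.z₃ + 3 * b.z₄ ∧
  0 < b.z₁ + b.z₃ ∧ 0 < b.z₁

def E₁ (b : Coord) : Prop := b.z₁ + b.z₂ + b.z₃ + 3 * b.z₄ < 0 ∧ b.z₁ + b.z₂ + 3 * b.z₄ < 0 ∧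
  b.z₁ + b.z₂ < 0 ∧ b.z₁ < 0
def E₂ (b : Coord) : Prop := b.z₁ + b.z₂ + b.z₃ + 3 * b.z₄ < 0 ∧ b.z₂ + 3 * b.z₄ < 0 ∧
  b.z₂ < 0 ∧ 0 ≤ b.z₁
def E₃ (b : Coord) : Prop := b.z₁ + b.z₃ + 3 * b.z₄ < 0 ∧ b.z₃ + 3 * b.z₄ < 0 ∧ b.z₄ < 0 ∧
  0 ≤ b.z₂ ∧ 0 ≤ b.z₁ + b.z₂
def E₄ (b : Coord) : Prop := 0 ≤ b.z₁ + b.z₂ + 3 * b.z₄ ∧ 0 ≤ b.z₂ + 3 * b.z₄ ∧ 0 ≤ b.z₄ ∧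
  b.z₃ < 0 ∧ b.z₁ + b.z₃ < 0
def E₅ (b : Coord) : Prop := 0 ≤ b.z₁ + b.z₂ + b.z₃ + 3 * b.z₄ ∧ 0 ≤ b.z₃ + 3 * b.z₄ ∧ 0 ≤ b.z₃ ∧
  b.z₁ < 0
def E₆ (b : Coord) : Prop := 0 ≤ b.z₁ + b.z₂ + b.z₃ + 3 * b.z₄ ∧ 0 ≤ b.z₁ + b.z₃ + 3 * b.z₄ ∧
  0 ≤ b.z₁ + b.z₃ ∧ 0 ≤ b.z₁

theorem F_exhaustive (b : Coord) : b.F₁ ∨ b.F₂ ∨ b.F₃ ∨ b.F₄ ∨ b.F₅ ∨ b.F₆ := by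
  simp only [F₁, F₂, F₃, F₄, F₅, F₆]
  grind (splits := 40)

theorem E_exhaustive (b : Coord) : b.E₁ ∨ b.E₂ ∨ b.E₃ ∨ b.E₄ ∨ b.E₅ ∨ b.E₆ := by
  simp only [E₁, E₂, E₃, E₄, E₅, E₆]
  grind (splits := 40)

/-! The Kashiwara operators on sextuples, before the test for membership in `𝓑_l`. -/

open Classical in
noncomputable def e₀ (b : Coord) : Coord :=
  if b.E₁ then { b with x₁ := b.x₁ - 1 }
  else if b.E₂ then { b with x₃ := b.x₃ - 1, y₃ := b.y₃ - 1, y₁ := b.y₁ + 1 }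
  else if b.E₃ then
    if b.z₄ = -1 / 3 then
      { b with x₂ := b.x₂ - 2 / 3, x₃ := b.x₃ - 2 / 3, y₃ := b.y₃ + 4 / 3, y₂ := b.y₂ + 1 / 3 }
    else if b.z₄ = -2 / 3 then
      { b with x₂ := b.x₂ - 1 / 3, x₃ := b.x₃ - 4 / 3, y₃ := b.y₃ + 2 / 3, y₂ := b.y₂ + 2 / 3 }
    else { b with x₃ := b.x₃ - 2, y₂ := b.y₂ + 1 }
  else if b.E₄ then { b with x₂ := b.x₂ - 1, y₃ := b.y₃ + 2 }
  else if b.E₅ then { b with x₁ := b.x₁ - 1, x₃ := b.x₃ + 1, y₃ := b.y₃ + 1 }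
  else { b with y₁ := b.y₁ + 1 }

open Classical in
noncomputable def f₀ (b : Coord) : Coord :=
  if b.F₁ then { b with x₁ := b.x₁ + 1 }
  else if b.F₂ then { b with x₃ := b.x₃ + 1, y₃ := b.y₃ + 1, y₁ := b.y₁ - 1 }
  else if b.F₃ then { b with x₃ := b.x₃ + 2, y₂ := b.y₂ - 1 }
  else if b.F₄ then
    if b.z₄ = 1 / 3 then
      { b with x₂ := b.x₂ + 1 / 3, x₃ := b.x₃ + 4 / 3, y₃ := b.y₃ - 2 / 3, y₂ := b.y₂ - 2 / 3 }
    else if b.z₄ = 2 / 3 then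
      { b with x₂ := b.x₂ + 2 / 3, x₃ := b.x₃ + 2 / 3, y₃ := b.y₃ - 4 / 3, y₂ := b.y₂ - 1 / 3 }
    else { b with x₂ := b.x₂ + 1, y₃ := b.y₃ - 2 }
  else if b.F₅ then { b with x₁ := b.x₁ + 1, x₃ := b.x₃ - 1, y₃ := b.y₃ - 1 }
  else { b with y₁ := b.y₁ - 1 }

/-- The three cases are `z₂ ≥ (-z₃)₊`, `z₂ < 0 ≤ z₃` and `(z₂)₊ < -z₃`. -/
def e₁ (b : Coord) : Coord :=
  if max (-b.z₃) 0 ≤ b.z₂ then { b with y₂ := b.y₂ + 1, y₁ := b.y₁ - 1 }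
  else if b.z₂ < 0 ∧ 0 ≤ b.z₃ then { b with x₃ := b.x₃ + 1, y₃ := b.y₃ - 1 }
  else { b with x₁ := b.x₁ + 1, x₂ := b.x₂ - 1 }

/-- The three cases are `(z₂)₊ ≤ -z₃`, `z₂ ≤ 0 < z₃` and `z₂ > (-z₃)₊`. -/
def f₁ (b : Coord) : Coord :=
  if max b.z₂ 0 ≤ -b.z₃ then { b with x₁ := b.x₁ - 1, x₂ := b.x₂ + 1 }
  else if b.z₂ ≤ 0 ∧ 0 < b.z₃ then { b with x₃ := b.x₃ - 1, y₃ := b.y₃ + 1 }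
  else { b with y₂ := b.y₂ - 1, y₁ := b.y₁ + 1 }

def e₂ (b : Coord) : Coord :=
  if 0 ≤ b.z₄ then { b with y₃ := b.y₃ + 2 / 3, y₂ := b.y₂ - 1 / 3 }
  else { b with x₂ := b.x₂ + 1 / 3, x₃ := b.x₃ - 2 / 3 }

def f₂ (b : Coord) : Coord :=
  if b.z₄ ≤ 0 then { b with x₂ := b.x₂ - 1 / 3, x₃ := b.x₃ + 2 / 3 }
  else { b with y₃ := b.y₃ - 2 / 3, y₂ := b.y₂ + 1 / 3 }

/-- `ε_i` on `𝓑_l`. -/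
def eps (l : ℕ) (b : Coord) : Fin 3 → ℚ :=
  ![l - b.s + b.maxA - (2 * b.z₁ + b.z₂ + b.z₃ + 3 * b.z₄),
    b.y₁ + max (b.y₃ - b.y₂ + max (b.x₂ - b.x₃) 0) 0,
    3 * b.y₂ + 3 / 2 * max (b.x₃ - b.y₃) 0]

/-- `φ_i` on `𝓑_l`. -/
def phi (l : ℕ) (b : Coord) : Fin 3 → ℚ :=
  ![l - b.s + b.maxA,
    b.x₁ + max (b.x₃ - b.x₂ + max (b.y₂ - b.y₃) 0) 0,
    3 * b.x₂ + 3 / 2 * max (b.y₃ - b.x₃) 0]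

end Coord

/-- The underlying set of the perfect crystal `𝓑_l`. -/
abbrev B (l : ℕ) : Type := {b : Coord // b.Mem l}

open Classical in
/-- A sextuple outside `𝓑_l` is read as `0`. -/
noncomputable def toB (l : ℕ) (b : Coord) : Option (B l) :=
  if h : b.Mem l then some ⟨b, h⟩ else none

/-- The perfect crystal `𝓑_l` of level `l`. -/
noncomputable def crystal (l : ℕ) : CrystalOps (B l) where
  wt b i := b.1.phi l i - b.1.eps l i
  e i b := toB l ((![b.1.e₀, b.1.e₁, b.1.e₂] : Fin 3 → Coord) i)
  f i b := toB l ((![b.1.f₀, b.1.f₁, b.1.f₂] : Fin 3 → Coord) i)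
  ε i b := b.1.eps l i
  φ i b := b.1.phi l i

/-- `R` is the combinatorial `R` matrix: a crystal isomorphism `𝓑_k ⊗ 𝓑_1 → 𝓑_1 ⊗ 𝓑_k`
(there is exactly one for every `k ≥ 1`). -/
def IsCombinatorialR (k : ℕ) (R : B k × B 1 ≃ B 1 × B k) : Prop :=
  IsCrystalIso ((crystal k).tensor (crystal 1)) ((crystal 1).tensor (crystal k)) R

/-- `H` is an energy function on `𝓑_k ⊗ 𝓑_1`, where `R (b ⊗ b') = b̃' ⊗ b̃` (such an `H` is unique
up to an additive constant). -/
def IsEnergyFunction (k : ℕ) (R : B k × B 1 ≃ B 1 × B k) (H : B k × B 1 → ℤ) : Prop :=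
  ∀ (i : Fin 3) (x y : B k × B 1), ((crystal k).tensor (crystal 1)).e i x = some y →
    ((i = 0 ∧ (crystal 1).ε 0 x.2 ≤ (crystal k).φ 0 x.1 ∧
        (crystal k).ε 0 (R x).2 ≤ (crystal 1).φ 0 (R x).1) → H y = H x + 1) ∧
    ((i = 0 ∧ (crystal k).φ 0 x.1 < (crystal 1).ε 0 x.2 ∧
        (crystal 1).φ 0 (R x).1 < (crystal k).ε 0 (R x).2) → H y = H x - 1) ∧
    (¬ (i = 0 ∧ (crystal 1).ε 0 x.2 ≤ (crystal k).φ 0 x.1 ∧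
        (crystal k).ε 0 (R x).2 ≤ (crystal 1).φ 0 (R x).1) →
      ¬ (i = 0 ∧ (crystal k).φ 0 x.1 < (crystal 1).ε 0 x.2 ∧
        (crystal 1).φ 0 (R x).1 < (crystal k).ε 0 (R x).2) → H y = H x)

/-- The vacuum carrier `u_l = (l, 0, 0, 0, 0, 0) ∈ 𝓑_l`. -/
def u (l : ℕ) : B l :=
  ⟨⟨l, 0, 0, 0, 0, 0⟩, by
    constructor
    · exact ⟨3 * l, by push_cast; ring⟩
    iterate 5 exact ⟨0, by norm_num⟩
    · exact ⟨0, by norm_num⟩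
    · simp [Coord.s]
    · exact ⟨l, by simp⟩
    iterate 3 exact ⟨0, by norm_num⟩⟩

/-- The letter `1 = (1, 0, 0, 0, 0, 0)` of `𝓑_1`. -/
def one : B 1 := u 1

/-- The letter `2 = (0, 1, 0, 0, 0, 0)`. -/
def two : B 1 :=
  ⟨⟨0, 1, 0, 0, 0, 0⟩, by
    constructor
    · exact ⟨0, by norm_num⟩
    · exact ⟨3, by norm_num⟩
    iterate 4 exact ⟨0, by norm_num⟩
    · exact ⟨0, by norm_num⟩
    · norm_num [Coord.s]
    iterate 2 exact ⟨0, by norm_num⟩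
    · exact ⟨1, by norm_num⟩
    · exact ⟨0, by norm_num⟩⟩

/-- The letter `2₁ = (0, 2/3, 2/3, 0, 0, 0)`. -/
def two₁ : B 1 :=
  ⟨⟨0, 2 / 3, 2 / 3, 0, 0, 0⟩, by
    constructor
    · exact ⟨0, by norm_num⟩
    iterate 2 exact ⟨2, by norm_num⟩
    iterate 3 exact ⟨0, by norm_num⟩
    · exact ⟨1, by norm_num⟩
    · norm_num [Coord.s]
    iterate 4 exact ⟨0, by norm_num⟩⟩

/-- The letter `2₂ = (0, 1/3, 4/3, 0, 0, 0)`. -/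
def two₂ : B 1 :=
  ⟨⟨0, 1 / 3, 4 / 3, 0, 0, 0⟩, by
    constructor
    · exact ⟨0, by norm_num⟩
    · exact ⟨1, by norm_num⟩
    · exact ⟨4, by norm_num⟩
    iterate 3 exact ⟨0, by norm_num⟩
    · exact ⟨2, by norm_num⟩
    · norm_num [Coord.s]
    iterate 2 exact ⟨0, by norm_num⟩
    · exact ⟨-1, by norm_num⟩
    · exact ⟨0, by norm_num⟩⟩

/-- The letter `3 = (0, 0, 2, 0, 0, 0)`. -/
def three : B 1 :=
  ⟨⟨0, 0, 2, 0, 0, 0⟩, by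
    constructor
    iterate 2 exact ⟨0, by norm_num⟩
    · exact ⟨6, by norm_num⟩
    iterate 3 exact ⟨0, by norm_num⟩
    · exact ⟨3, by norm_num⟩
    · norm_num [Coord.s]
    iterate 2 exact ⟨0, by norm_num⟩
    · exact ⟨-2, by norm_num⟩
    · exact ⟨0, by norm_num⟩⟩

/-- Apply `R_{L,L+1} ⋯ R_{23} R_{12}` to `v ⊗ b₁ ⊗ ⋯ ⊗ b_L`. The result is
`b̃₁ ⊗ ⋯ ⊗ b̃_L ⊗ u^{(L)}`, where `u^{(0)} = v` and
`R (u^{(i)} ⊗ b_{i+1}) = b̃_{i+1} ⊗ u^{(i+1)}`; it is returned as the list of the `b̃_i` together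
with `u^{(L)}`. -/
def row {k : ℕ} (R : B k × B 1 ≃ B 1 × B k) : B k → List (B 1) → List (B 1) × B k
  | v, [] => ([], v)
  | v, b :: p => ((R (v, b)).1 :: (row R (R (v, b)).2 p).1, (row R (R (v, b)).2 p).2)

/-- `T_k(p) = q`, that is, `R_{L,L+1} ⋯ R_{12} (u_k ⊗ p) = q ⊗ u_k`. -/
def IsTimeEvolution {k : ℕ} (R : B k × B 1 ≃ B 1 × B k) (p q : List (B 1)) : Prop :=
  row R (u k) p = (q, u k)

/-- The sum of `H (u^{(i)} ⊗ b_{i+1})` over `i = 0, …, L - 1`, with `u^{(0)} = v`. -/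
def rowSum {k : ℕ} (R : B k × B 1 ≃ B 1 × B k) (H : B k × B 1 → ℤ) : B k → List (B 1) → ℤ
  | _, [] => 0
  | v, b :: p => H (v, b) + rowSum R H (R (v, b)).2 p

/-- The state energy `E_k(p) = - ∑ H (u^{(i)} ⊗ b_{i+1})`, with `u^{(0)} = u_k`. -/
def stateEnergy {k : ℕ} (R : B k × B 1 ≃ B 1 × B k) (H : B k × B 1 → ℤ) (p : List (B 1)) : ℤ :=
  - rowSum R H (u k) p

/-- `s` is a soliton `[l]` of length `l`: one of `3^m 2^(l-m)`, `3^m 2₁ 2^(l-m-1)`,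
`3^m 2₂ 2^(l-m-1)`. -/
def IsSoliton (l : ℕ) (s : List (B 1)) : Prop :=
  ∃ m n : ℕ,
    (m + n = l ∧ s = List.replicate m three ++ List.replicate n two) ∨
    (m + 1 + n = l ∧ s = List.replicate m three ++ two₁ :: List.replicate n two) ∨
    (m + 1 + n = l ∧ s = List.replicate m three ++ two₂ :: List.replicate n two)

/-- The state `1^a ⊗ s ⊗ 1^r`. -/
def embed (a : ℕ) (s : List (B 1)) (r : ℕ) : List (B 1) :=
  List.replicate a one ++ s ++ List.replicate r one

end G2SCA

namespace G2SCA

/-! Two ideas carry the proof: the operator `f̃₂` reduces every soliton to `2^{⊗ l}`, and for that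
soliton `R` and `H` are needed only at a few elements, where they are forced by following crystal
arrows from `u_k ⊗ 1`.

Reduction. The product `R_{L,L+1} ⋯ R_{12}` commutes with `f̃₂`, and `H` is constant along arrows of
nonzero colour. Since `φ₂(u_k) = 0`, `f̃₂` leaves the carrier `u_k` untouched on both sides. So
`f̃₂` preserves the energy and commutes with `T_k` when `T_k` is defined (`soliton_of_isStep`). The
letters 1 and 3 have `φ₂ = 0`, and 1 and 2 have `ε₂ = 0`, so repeated `f̃₂` turns the 2's into 3's
from the left through `2 → 2₁ → 2₂ → 3` and reaches all solitons (`IsSoliton.induction`).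

Computation. The weight `2h₁ + h₂` is maximal only at `u_k`, which gives `R(u_k ⊗ 1) = 1 ⊗ u_k`. Two
`ẽ₀` turn the letter into `(0,0,0,0,0,1)`. Now `ẽ₁` reaches the letter only if the carrier has no 1,
so the carrier is emptied by `ẽ₀`, `ẽ₁` makes the letter `(0,0,0,0,1,0)`, and `f̃₀` refills the
carrier. One more `f̃₀` and three `ẽ₂` lead to `u_k ⊗ 3` and `u_k ⊗ 2`, with `H = -1`. Arrows of
colour 1 give the remaining values on carriers `(i,j,0,0,0,0)`, `i + j = k`: a 2 is absorbed in
exchange for a 1 at `H = -1` until the carrier is full, further 2's pass at `H = 0`, and trailing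
1's release the stored 2's at `H = 0` (`soliton_twos`). -/

theorem toB_eq_some {l : ℕ} {c : Coord} {b : B l} : toB l c = some b ↔ c = b.1 := by
  unfold toB
  constructor
  · intro h
    split_ifs at h with hc
    rw [← Option.some.inj h]
  · rintro rfl
    rw [dif_pos b.2]

theorem IsThird.nonneg {q : ℚ} (h : IsThird q) : 0 ≤ q := by
  obtain ⟨n, rfl⟩ := h
  positivity

/-! ### The tensor product rule -/

section Tensor

variable {B₁ B₂ B₃ : Type} {C₁ : CrystalOps B₁} {C₂ : CrystalOps B₂} {C₃ : CrystalOps B₃}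
  {i : Fin 3} {b b' : B₁} {c c' : B₂}

theorem tensor_f_left (h : C₂.ε i c < C₁.φ i b) (hf : C₁.f i b = some b') :
    (C₁.tensor C₂).f i (b, c) = some (b', c) := by
  simp [CrystalOps.tensor, h, hf]

theorem tensor_f_right (h : C₁.φ i b ≤ C₂.ε i c) (hf : C₂.f i c = some c') :
    (C₁.tensor C₂).f i (b, c) = some (b, c') := by
  simp [CrystalOps.tensor, not_lt.2 h, hf]

theorem tensor_e_left (h : C₂.ε i c ≤ C₁.φ i b) (he : C₁.e i b = some b') :
    (C₁.tensor C₂).e i (b, c) = some (b', c) := by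
  simp [CrystalOps.tensor, h, he]

theorem tensor_e_right (h : C₁.φ i b < C₂.ε i c) (he : C₂.e i c = some c') :
    (C₁.tensor C₂).e i (b, c) = some (b, c') := by
  simp [CrystalOps.tensor, not_le.2 h, he]

theorem tensor_f_eq_some {x : B₁ × B₂} (h : (C₁.tensor C₂).f i (b, c) = some x) :
    (C₂.ε i c < C₁.φ i b ∧ C₁.f i b = some x.1 ∧ x.2 = c) ∨
      (C₁.φ i b ≤ C₂.ε i c ∧ C₂.f i c = some x.2 ∧ x.1 = b) := by
  simp only [CrystalOps.tensor] at h
  split_ifs at h with hlt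
  · obtain ⟨d, hd, rfl⟩ := Option.map_eq_some_iff.1 h
    exact .inl ⟨hlt, hd, rfl⟩
  · obtain ⟨d, hd, rfl⟩ := Option.map_eq_some_iff.1 h
    exact .inr ⟨not_lt.1 hlt, hd, rfl⟩

end Tensor

/-! ### Integrality, and the 1- and 2-arrows as arrows inverted by `ẽ₁`, `ẽ₂` -/

namespace Coord

theorem Mem.nonneg {l : ℕ} {b : Coord} (h : b.Mem l) :
    0 ≤ b.x₁ ∧ 0 ≤ b.x₂ ∧ 0 ≤ b.x₃ ∧ 0 ≤ b.y₃ ∧ 0 ≤ b.y₂ ∧ 0 ≤ b.y₁ :=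
  ⟨h.hx₁.nonneg, h.hx₂.nonneg, h.hx₃.nonneg, h.hy₃.nonneg, h.hy₂.nonneg, h.hy₁.nonneg⟩

theorem Mem.exists_int {l : ℕ} {b : Coord} (h : b.Mem l) :
    ∃ n₁ n₂ n₃ n₄ : ℤ, b.x₁ = n₁ ∧ b.y₁ = n₂ ∧ b.z₂ = n₃ ∧ b.z₃ = n₄ := by
  obtain ⟨n₁, h₁⟩ := h.int₁
  obtain ⟨n₂, h₂⟩ := h.int₂
  obtain ⟨n₃, h₃⟩ := h.int₃
  obtain ⟨n₄, h₄⟩ := h.int₄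
  exact ⟨n₁, n₂, -n₄, -n₃, h₁, h₂, by push_cast; rw [← h₄, z₂]; ring,
    by push_cast; rw [← h₃, z₃]; ring⟩

end Coord

/-- The values of `ε_i` and `φ_i` are integers, and `ẽ_i`, `ε_i`, `φ_i` are compatible with `f̃_i`
along every `i`-arrow. -/
def IsArrow {B₁ : Type} (C : CrystalOps B₁) (i : Fin 3) : Prop :=
  (∀ b b', C.f i b = some b' → C.e i b' = some b ∧ C.φ i b' = C.φ i b - 1 ∧
    C.ε i b' = C.ε i b + 1) ∧ ∀ b, IsInt (C.φ i b) ∧ IsInt (C.ε i b)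

theorem IsArrow.tensor_e {B₁ B₂ : Type} {C₁ : CrystalOps B₁} {C₂ : CrystalOps B₂} {i : Fin 3}
    (h₁ : IsArrow C₁ i) (h₂ : IsArrow C₂ i) {x y : B₁ × B₂}
    (h : (C₁.tensor C₂).f i x = some y) : (C₁.tensor C₂).e i y = some x := by
  obtain ⟨b, c⟩ := x
  obtain ⟨b', c'⟩ := y
  obtain ⟨hlt, hf, h⟩ | ⟨hlt, hf, h⟩ := tensor_f_eq_some h
  · obtain rfl : c' = c := h
    obtain ⟨he, hφ, -⟩ := h₁.1 _ _ hf
    refine tensor_e_left ?_ he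
    obtain ⟨m, hm⟩ := (h₁.2 b).1
    obtain ⟨n, hn⟩ := (h₂.2 c').2
    dsimp only at hφ ⊢
    rw [hφ, hm, hn]
    rw [hm, hn] at hlt
    have : n < m := by exact_mod_cast hlt
    -- Integrality is essential: after `f̃_i` has lowered `φ_i(b)` by 1, the non-strict test of
    -- `ẽ_i` must still select the left factor.
    have : n ≤ m - 1 := by omega
    exact_mod_cast this
  · obtain rfl : b' = b := h
    obtain ⟨he, -, hε⟩ := h₂.1 _ _ hf
    refine tensor_e_right ?_ he
    dsimp only at hε ⊢
    linarith

theorem IsInt.max {p q : ℚ} (hp : IsInt p) (hq : IsInt q) : IsInt (max p q) := by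
  rcases max_choice p q with h | h <;> rwa [h]

theorem IsInt.add {p q : ℚ} (hp : IsInt p) (hq : IsInt q) : IsInt (p + q) := by
  obtain ⟨m, rfl⟩ := hp
  obtain ⟨n, rfl⟩ := hq
  exact ⟨m + n, by push_cast; ring⟩

theorem IsInt.neg {p : ℚ} (hp : IsInt p) : IsInt (-p) := by
  obtain ⟨m, rfl⟩ := hp
  exact ⟨-m, by push_cast; ring⟩

theorem isInt_zero : IsInt 0 := ⟨0, by norm_num⟩

theorem IsThird.isInt {q : ℚ} (h : IsThird q) : IsInt (3 * q) := by
  obtain ⟨n, rfl⟩ := h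
  exact ⟨n, by push_cast; ring⟩

namespace Coord

/-- `f̃₁` lowers `z₂` or `z₃` (or both) by 1. By integrality a positive quantity stays nonnegative,
so the result lies in the matching case of `ẽ₁`. -/
theorem Mem.one_le_z {l : ℕ} {b : Coord} (h : b.Mem l) : (0 < b.z₂ → 1 ≤ b.z₂) ∧
    (0 < b.z₃ → 1 ≤ b.z₃) ∧ (0 < b.z₂ + b.z₃ → 1 ≤ b.z₂ + b.z₃) := by
  obtain ⟨-, -, m, n, -, -, hm, hn⟩ := h.exists_int
  rw [hm, hn]
  norm_cast
  omega

theorem Mem.f₁_arrow {l : ℕ} {b : Coord} (h : b.Mem l) : b.f₁.e₁ = b ∧ b.f₁.phi l 1 = b.phi l 1 - 1 ∧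
    b.f₁.eps l 1 = b.eps l 1 + 1 := by
  obtain ⟨h₂, h₃, h₂₃⟩ := h.one_le_z
  simp only [eps, phi, Matrix.cons_val_one, Matrix.cons_val_zero]
  by_cases hA : max b.z₂ 0 ≤ -b.z₃
  · rw [show b.f₁ = { b with x₁ := b.x₁ - 1, x₂ := b.x₂ + 1 } from if_pos hA]
    simp only [z₂, z₃] at hA
    refine ⟨?_, ?_, ?_⟩
    · rw [e₁, if_neg, if_neg, Coord.ext_iff]
      · simp
      all_goals simp only [z₂, z₃]; grind
    · grind
    · grind
  · by_cases hB : b.z₂ ≤ 0 ∧ 0 < b.z₃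
    · rw [show b.f₁ = { b with x₃ := b.x₃ - 1, y₃ := b.y₃ + 1 } from
        (if_neg hA).trans (if_pos hB)]
      have h₃ := h₃ hB.2
      simp only [z₂, z₃] at hB h₃
      refine ⟨?_, ?_, ?_⟩
      · rw [e₁, if_neg, if_pos, Coord.ext_iff]
        · simp
        all_goals simp only [z₂, z₃]; grind
      · grind
      · grind
    · rw [show b.f₁ = { b with y₂ := b.y₂ - 1, y₁ := b.y₁ + 1 } from
        (if_neg hA).trans (if_neg hB)]
      have h₂ := h₂ (by grind)
      have h₂₃ := h₂₃ (by grind)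
      simp only [z₂, z₃] at h₂ h₂₃
      refine ⟨?_, ?_, ?_⟩
      · rw [e₁, if_pos, Coord.ext_iff]
        · simp
        all_goals simp only [z₂, z₃]; grind
      · grind
      · grind

theorem Mem.f₂_arrow {l : ℕ} {b : Coord} (h : b.Mem l) : b.f₂.e₂ = b ∧
    b.f₂.phi l 2 = b.phi l 2 - 1 ∧ b.f₂.eps l 2 = b.eps l 2 + 1 := by
  simp only [eps, phi, Matrix.cons_val]
  by_cases hA : b.z₄ ≤ 0
  · rw [show b.f₂ = { b with x₂ := b.x₂ - 1 / 3, x₃ := b.x₃ + 2 / 3 } from if_pos hA]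
    simp only [z₄] at hA
    refine ⟨?_, ?_, ?_⟩
    · rw [e₂, if_neg, Coord.ext_iff]
      · simp
      · simp only [z₄]; grind
    · grind
    · grind
  · rw [show b.f₂ = { b with y₃ := b.y₃ - 2 / 3, y₂ := b.y₂ + 1 / 3 } from if_neg hA]
    simp only [z₄] at hA
    -- By the parity condition `z₄ = -n/3`, so `z₄ > 0` means `z₄ ≥ 1/3`. This branch of `f̃₂`
    -- lowers `z₄` by 1/3, so `ẽ₂` sees `z₄ ≥ 0` and undoes it.
    obtain ⟨n, hn⟩ := h.parity
    have hn : (n : ℚ) < 0 := by linarith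
    have hn : n ≤ -1 := by
      have : n < 0 := by exact_mod_cast hn
      omega
    have hn : (n : ℚ) ≤ -1 := by exact_mod_cast hn
    refine ⟨?_, ?_, ?_⟩
    · rw [e₂, if_pos, Coord.ext_iff]
      · simp
      · simp only [z₄]; linarith
    · grind
    · grind

end Coord

theorem isArrow_one (k : ℕ) : IsArrow (crystal k) 1 := by
  constructor
  · rintro b ⟨_, hb'⟩ h
    simp only [crystal, toB_eq_some, Matrix.cons_val_one, Matrix.cons_val_zero] at h ⊢
    subst h
    exact b.2.f₁_arrow
  · rintro ⟨b, hb⟩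
    simp only [crystal, Coord.eps, Coord.phi, Matrix.cons_val_one, Matrix.cons_val_zero]
    have h₁ := hb.int₁
    have h₂ := hb.int₂
    have h₃ := hb.int₃
    have h₄ := hb.int₄
    have h₅ := h₃.neg
    have h₆ := h₄.neg
    rw [neg_sub] at h₅ h₆
    exact ⟨h₁.add ((h₅.add (h₆.max isInt_zero)).max isInt_zero),
      h₂.add ((h₄.add (h₃.max isInt_zero)).max isInt_zero)⟩

theorem isArrow_two (k : ℕ) : IsArrow (crystal k) 2 := by
  constructor
  · rintro b ⟨_, hb'⟩ h
    simp only [crystal, toB_eq_some, Matrix.cons_val] at h ⊢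
    subst h
    exact b.2.f₂_arrow
  · rintro ⟨b, hb⟩
    obtain ⟨n, hn⟩ := hb.parity
    have h₁ : IsInt (3 / 2 * max (b.y₃ - b.x₃) 0) := by
      rw [mul_max_of_nonneg _ _ (by norm_num), mul_zero]
      exact IsInt.max ⟨-n, by push_cast; linarith⟩ isInt_zero
    have h₂ : IsInt (3 / 2 * max (b.x₃ - b.y₃) 0) := by
      rw [mul_max_of_nonneg _ _ (by norm_num), mul_zero]
      exact IsInt.max ⟨n, by linarith⟩ isInt_zero
    exact ⟨hb.hx₂.isInt.add h₁, hb.hy₂.isInt.add h₂⟩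

theorem eps_two_nonneg {k : ℕ} (b : B k) : 0 ≤ (crystal k).ε 2 b := by
  have := b.2.nonneg
  have := le_max_right (b.1.x₃ - b.1.y₃) 0
  simp only [crystal, Coord.eps, Matrix.cons_val]
  linarith

theorem phi_two_nonneg {k : ℕ} (b : B k) : 0 ≤ (crystal k).φ 2 b := by
  have := b.2.nonneg
  have := le_max_right (b.1.y₃ - b.1.x₃) 0
  simp only [crystal, Coord.phi, Matrix.cons_val]
  linarith

/-- `Ψ` commutes with the `i`-arrows and preserves weights, `ε_i` and `φ_i`. -/
def IsHom {B₁ B₂ : Type} (C₁ : CrystalOps B₁) (C₂ : CrystalOps B₂) (i : Fin 3) (Ψ : B₁ → B₂) :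
    Prop :=
  (∀ b, C₂.wt (Ψ b) i = C₁.wt b i ∧ C₂.ε i (Ψ b) = C₁.ε i b ∧ C₂.φ i (Ψ b) = C₁.φ i b) ∧
    ∀ b b', C₁.f i b = some b' → C₂.f i (Ψ b) = some (Ψ b')

/-! ### Maps respecting the arrows of one colour -/

section Hom

variable {B₁ B₂ B₃ : Type} {C₁ : CrystalOps B₁} {C₂ : CrystalOps B₂} {C₃ : CrystalOps B₃}
  {i : Fin 3}

theorem IsCrystalIso.isHom {Ψ : B₁ ≃ B₂} (h : IsCrystalIso C₁ C₂ Ψ) : IsHom C₁ C₂ i Ψ :=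
  ⟨fun b => h.1 b i, fun b b' hb => (h.2 b b' i hb).1⟩

theorem IsHom.comp {Ψ : B₁ → B₂} {Φ : B₂ → B₃} (hΦ : IsHom C₂ C₃ i Φ) (hΨ : IsHom C₁ C₂ i Ψ) :
    IsHom C₁ C₃ i (Φ ∘ Ψ) := by
  refine ⟨fun b => ?_, fun b b' h => hΦ.2 _ _ (hΨ.2 _ _ h)⟩
  obtain ⟨h₁, h₂, h₃⟩ := hΨ.1 b
  obtain ⟨h₁', h₂', h₃'⟩ := hΦ.1 (Ψ b)
  exact ⟨h₁'.trans h₁, h₂'.trans h₂, h₃'.trans h₃⟩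

theorem IsHom.tensor_right {Ψ : B₂ → B₃} (h : IsHom C₂ C₃ i Ψ) :
    IsHom (C₁.tensor C₂) (C₁.tensor C₃) i (Prod.map id Ψ) := by
  refine ⟨fun ⟨b, c⟩ => ?_, fun ⟨b, c⟩ ⟨b', c'⟩ hf => ?_⟩
  · obtain ⟨h₁, h₂, h₃⟩ := h.1 c
    simp only [CrystalOps.tensor, Prod.map, id, h₁, h₂, h₃, and_self]
  · obtain ⟨-, h₂, -⟩ := h.1 c
    obtain ⟨hlt, hf₁, hc₁⟩ | ⟨hlt, hf₁, hc₁⟩ := tensor_f_eq_some hf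
    · obtain rfl : c' = c := hc₁
      exact tensor_f_left (by rwa [h₂]) hf₁
    · obtain rfl : b' = b := hc₁
      exact tensor_f_right (by rwa [h₂]) (h.2 _ _ hf₁)

theorem IsHom.tensor_left {Ψ : B₁ → B₂} (h : IsHom C₁ C₂ i Ψ) :
    IsHom (C₁.tensor C₃) (C₂.tensor C₃) i (Prod.map Ψ id) := by
  refine ⟨fun ⟨b, c⟩ => ?_, fun ⟨b, c⟩ ⟨b', c'⟩ hf => ?_⟩
  · obtain ⟨h₁, h₂, h₃⟩ := h.1 b
    simp only [CrystalOps.tensor, Prod.map, id, h₁, h₂, h₃, and_self]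
  · obtain ⟨-, -, h₃⟩ := h.1 b
    obtain ⟨hlt, hf₁, hc₁⟩ | ⟨hlt, hf₁, hc₁⟩ := tensor_f_eq_some hf
    · obtain rfl : c' = c := hc₁
      exact tensor_f_left (by rwa [h₃]) (h.2 _ _ hf₁)
    · obtain rfl : b' = b := hc₁
      exact tensor_f_right (by rwa [h₃]) hf₁

/-- When `wt = φ - ε` on the middle factor, `φ a > ε b` is equivalent to `φ a + wt b > φ b`. Both
bracketings then make equivalent comparisons and act on the same factor. -/
theorem isHom_assoc (hwt : ∀ b, C₂.wt b i = C₂.φ i b - C₂.ε i b) :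
    IsHom ((C₁.tensor C₂).tensor C₃) (C₁.tensor (C₂.tensor C₃)) i
      (Equiv.prodAssoc B₁ B₂ B₃) := by
  refine ⟨fun ⟨⟨a, b⟩, c⟩ => ?_, fun ⟨⟨a, b⟩, c⟩ ⟨⟨a', b'⟩, c'⟩ hf => ?_⟩
  · simp only [CrystalOps.tensor, Equiv.prodAssoc_apply]
    refine ⟨(add_assoc _ _ _).symm, ?_, ?_⟩ <;> grind
  · have hb := hwt b
    simp only [Equiv.prodAssoc_apply]
    obtain ⟨hlt, hf₁, hc₁⟩ | ⟨hlt, hf₁, hc₁⟩ := tensor_f_eq_some hf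
    · obtain rfl : c' = c := hc₁
      obtain ⟨hlt₂, hf₂, hc₂⟩ | ⟨hlt₂, hf₂, hc₂⟩ := tensor_f_eq_some hf₁
      · obtain rfl : b' = b := hc₂
        refine tensor_f_left ?_ hf₂
        simp only [CrystalOps.tensor] at hlt ⊢
        grind
      · obtain rfl : a' = a := hc₂
        refine tensor_f_right ?_ (tensor_f_left ?_ hf₂)
        all_goals
          simp only [CrystalOps.tensor] at hlt ⊢
          grind
    · obtain ⟨rfl, rfl⟩ : a' = a ∧ b' = b := Prod.ext_iff.1 hc₁
      refine tensor_f_right ?_ (tensor_f_right ?_ hf₁)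
      all_goals
        simp only [CrystalOps.tensor] at hlt ⊢
        grind

/-- Needed separately because `IsHom` asks only that arrows be preserved, not reflected. -/
theorem isHom_assoc_symm (hwt : ∀ b, C₂.wt b i = C₂.φ i b - C₂.ε i b) :
    IsHom (C₁.tensor (C₂.tensor C₃)) ((C₁.tensor C₂).tensor C₃) i
      (Equiv.prodAssoc B₁ B₂ B₃).symm := by
  refine ⟨fun ⟨a, b, c⟩ => ?_, fun ⟨a, b, c⟩ ⟨a', b', c'⟩ hf => ?_⟩
  · obtain ⟨h₁, h₂, h₃⟩ := (isHom_assoc (C₁ := C₁) (C₃ := C₃) hwt).1 ((a, b), c)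
    exact ⟨h₁.symm, h₂.symm, h₃.symm⟩
  · have hb := hwt b
    simp only [Equiv.prodAssoc_symm_apply]
    obtain ⟨hlt, hf₁, hc₁⟩ | ⟨hlt, hf₁, hc₁⟩ := tensor_f_eq_some hf
    · obtain ⟨rfl, rfl⟩ : b' = b ∧ c' = c := Prod.ext_iff.1 hc₁
      refine tensor_f_left ?_ (tensor_f_left ?_ hf₁)
      all_goals
        simp only [CrystalOps.tensor] at hlt ⊢
        grind
    · obtain rfl : a' = a := hc₁
      obtain ⟨hlt₂, hf₂, hc₂⟩ | ⟨hlt₂, hf₂, hc₂⟩ := tensor_f_eq_some hf₁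
      · obtain rfl : c' = c := hc₂
        refine tensor_f_left ?_ (tensor_f_right ?_ hf₂)
        all_goals
          simp only [CrystalOps.tensor] at hlt ⊢
          grind
      · obtain rfl : b' = b := hc₂
        refine tensor_f_right ?_ hf₂
        simp only [CrystalOps.tensor] at hlt ⊢
        grind

end Hom

/-! ### Passing a carrier through a word commutes with `f̃₂` -/

/-- The set `𝓑_1^{⊗ n}`. -/
def Word : ℕ → Type
  | 0 => Unit
  | n + 1 => B 1 × Word n

/-- The crystal `𝓑_1^{⊗ n}`; for `n = 0` it is the trivial one. -/
noncomputable def word : (n : ℕ) → CrystalOps (Word n)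
  | 0 => ⟨fun _ _ => 0, fun _ _ => none, fun _ _ => none, fun _ _ => 0, fun _ _ => 0⟩
  | n + 1 => (crystal 1).tensor (word n)

def Word.toList : {n : ℕ} → Word n → List (B 1)
  | 0, _ => []
  | _ + 1, p => p.1 :: Word.toList p.2

theorem crystal_wt {k : ℕ} (b : B k) (i : Fin 3) :
    (crystal k).wt b i = (crystal k).φ i b - (crystal k).ε i b := rfl

theorem word_wt {n : ℕ} (p : Word n) (i : Fin 3) :
    (word n).wt p i = (word n).φ i p - (word n).ε i p := by
  induction n with
  | zero => simp [word]
  | succ n ih =>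
    have h₁ := crystal_wt p.1 i
    have h₂ := ih p.2
    simp only [word, CrystalOps.tensor] at *
    grind

theorem word_eps_two_nonneg {n : ℕ} (p : Word n) : 0 ≤ (word n).ε 2 p := by
  cases n with
  | zero => exact le_rfl
  | succ n => exact (eps_two_nonneg p.1).trans (le_max_left _ _)

section Row

variable {k : ℕ} {R : B k × B 1 ≃ B 1 × B k} {H : B k × B 1 → ℤ}

/-- `row` on `𝓑_k ⊗ 𝓑_1^{⊗ n}`. -/
def wordRow (R : B k × B 1 ≃ B 1 × B k) : (n : ℕ) → B k × Word n → Word n × B k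
  | 0 => Prod.swap
  | n + 1 => (Equiv.prodAssoc _ _ _).symm ∘ Prod.map id (wordRow R n) ∘
      (Equiv.prodAssoc _ _ _) ∘ Prod.map R id ∘ (Equiv.prodAssoc _ _ _).symm

/-- Replaces the recursion `row` by a composite of `R` and reassociations, each of which respects
2-arrows. -/
theorem row_toList {n : ℕ} (v : B k) (p : Word n) :
    row R v p.toList = ((wordRow R n (v, p)).1.toList, (wordRow R n (v, p)).2) := by
  induction n generalizing v with
  | zero => rfl
  | succ n ih =>
    obtain ⟨b, p⟩ := p
    simp only [Word.toList, row, ih]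
    rfl

theorem IsCombinatorialR.isHom_wordRow (hR : IsCombinatorialR k R) (n : ℕ) :
    IsHom ((crystal k).tensor (word n)) ((word n).tensor (crystal k)) 2 (wordRow R n) := by
  induction n with
  | zero =>
    refine ⟨fun ⟨v, p⟩ => ?_, fun ⟨v, p⟩ ⟨v', p'⟩ hf => ?_⟩
    · have hε := eps_two_nonneg v
      have hφ := phi_two_nonneg v
      have hw := crystal_wt v 2
      simp only [wordRow, word, CrystalOps.tensor, Prod.swap]
      grind
    · obtain ⟨-, hf, -⟩ | ⟨-, hf, -⟩ := tensor_f_eq_some hf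
      · exact tensor_f_right (eps_two_nonneg v) hf
      · simp [word] at hf
  | succ n ih =>
    exact (isHom_assoc_symm (word_wt · 2)).comp (ih.tensor_right.comp
      ((isHom_assoc (crystal_wt · 2)).comp ((IsCrystalIso.isHom hR).tensor_left.comp
        (isHom_assoc_symm (crystal_wt · 2)))))

/-- The energy axiom speaks of `ẽ_i`, so the arrow is inverted in the tensor product, which the
integrality argument permits for `i = 1, 2`. -/
theorem IsEnergyFunction.eq_of_f (hH : IsEnergyFunction k R H) {i : Fin 3} (hi : i ≠ 0)
    {x y : B k × B 1} (h : ((crystal k).tensor (crystal 1)).f i x = some y) : H y = H x := by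
  have he : ((crystal k).tensor (crystal 1)).e i y = some x := by
    obtain rfl | rfl : i = 1 ∨ i = 2 := by omega
    · exact (isArrow_one k).tensor_e (isArrow_one 1) h
    · exact (isArrow_two k).tensor_e (isArrow_two 1) h
  exact ((hH i y x he).2.2 (fun h => hi h.1) fun h => hi h.1).symm

/-- A 2-arrow on `v ⊗ b ⊗ p` either moves `v ⊗ b`, along which `H` is constant, or fixes it. After
`R`, it either moves the emitted letter, so that the rest of the sum sees the same data, or moves
the new carrier with `p`, where induction applies. -/
theorem IsEnergyFunction.rowSum_eq_of_f_two (hH : IsEnergyFunction k R H)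
    (hR : IsCombinatorialR k R) {n : ℕ} {v v' : B k} {p p' : Word n}
    (h : ((crystal k).tensor (word n)).f 2 (v, p) = some (v', p')) :
    rowSum R H v' p'.toList = rowSum R H v p.toList := by
  induction n generalizing v v' with
  | zero => rfl
  | succ n ih =>
    obtain ⟨b, p⟩ := p
    obtain ⟨b', p'⟩ := p'
    have h₁ := (isHom_assoc_symm (C₁ := crystal k) (C₃ := word n)
      (crystal_wt (k := 1) · 2)).2 (v, b, p) (v', b', p') h
    have h₂ := ((isHom_assoc (crystal_wt · 2)).comp
      (IsCrystalIso.isHom (i := 2) hR).tensor_left).2 _ _ h₁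
    simp only [Function.comp, Prod.map, Equiv.prodAssoc_apply, Equiv.prodAssoc_symm_apply,
      id] at h₁ h₂
    simp only [Word.toList, rowSum]
    congr 1
    · obtain ⟨-, h, -⟩ | ⟨-, -, h⟩ := tensor_f_eq_some h₁
      · exact hH.eq_of_f (by decide) h
      · exact congrArg H h
    · obtain ⟨-, -, h⟩ | ⟨-, h, -⟩ := tensor_f_eq_some h₂
      · obtain ⟨hv, rfl⟩ := Prod.ext_iff.1 h
        exact congrArg (rowSum R H · _) hv
      · exact ih h

end Row

/-! ### The action of `f̃₂` on states -/

/-- `f̃₂ p = p'` in `𝓑_1^{⊗ L}`. -/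
def IsStep (p p' : List (B 1)) : Prop :=
  ∃ n, ∃ x y : Word n, x.toList = p ∧ y.toList = p' ∧ (word n).f 2 x = some y

/-- A letter with `φ₂ = 0` never exceeds the nonnegative `ε₂` of what follows, so `f̃₂` skips it. -/
theorem IsStep.cons {p p' : List (B 1)} (h : IsStep p p') {b : B 1}
    (hb : (crystal 1).φ 2 b = 0) : IsStep (b :: p) (b :: p') := by
  obtain ⟨n, x, y, rfl, rfl, h⟩ := h
  exact ⟨n + 1, (b, x), (b, y), rfl, rfl,
    tensor_f_right (hb.trans_le (word_eps_two_nonneg x)) h⟩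

theorem IsStep.replicate_append {p p' : List (B 1)} (h : IsStep p p') {b : B 1}
    (hb : (crystal 1).φ 2 b = 0) (m : ℕ) :
    IsStep (List.replicate m b ++ p) (List.replicate m b ++ p') := by
  induction m with
  | zero => exact h
  | succ m ih => exact ih.cons hb

theorem exists_word_eps_two_eq_zero (p : List (B 1)) (h : ∀ b ∈ p, (crystal 1).ε 2 b = 0) :
    ∃ n, ∃ x : Word n, x.toList = p ∧ (word n).ε 2 x = 0 := by
  induction p with
  | nil => exact ⟨0, (), rfl, rfl⟩
  | cons b p ih =>
    obtain ⟨n, x, rfl, hx⟩ := ih fun c hc => h c (List.mem_cons_of_mem b hc)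
    refine ⟨n + 1, (b, x), rfl, ?_⟩
    have hb := h b List.mem_cons_self
    have hw := crystal_wt b 2
    have := phi_two_nonneg b
    simp only [word, CrystalOps.tensor, hb, hx]
    exact max_eq_left (by linarith)

/-- If every later letter has `ε₂ = 0`, the whole tail has `ε₂ = 0`, and a positive `φ₂` at the head
wins the comparison. -/
theorem IsStep.head {b b' : B 1} {p : List (B 1)} (hf : (crystal 1).f 2 b = some b')
    (hb : 0 < (crystal 1).φ 2 b) (h : ∀ c ∈ p, (crystal 1).ε 2 c = 0) :
    IsStep (b :: p) (b' :: p) := by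
  obtain ⟨n, x, rfl, hx⟩ := exists_word_eps_two_eq_zero p h
  exact ⟨n + 1, (b, x), (b', x), rfl, rfl, tensor_f_left (hx.trans_lt hb) hf⟩

/-! ### The crystal elements met along the path, and their arrows -/

/-- The element `(x₁, x₂, 2x₃, 0, ȳ₂, ȳ₁)` of `𝓑_k` with integers `x₁, …, ȳ₁`. -/
def pt {k : ℕ} (x₁ x₂ x₃ y₂ y₁ : ℕ) (h : x₁ + x₂ + x₃ + y₂ + y₁ ≤ k) : B k :=
  ⟨⟨x₁, x₂, 2 * x₃, 0, y₂, y₁⟩, by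
    have h' : ((x₁ + x₂ + x₃ + y₂ + y₁ : ℕ) : ℚ) ≤ k := by exact_mod_cast h
    push_cast at h'
    constructor
    · exact ⟨3 * x₁, by push_cast; ring⟩
    · exact ⟨3 * x₂, by push_cast; ring⟩
    · exact ⟨6 * x₃, by push_cast; ring⟩
    · exact ⟨0, by norm_num⟩
    · exact ⟨3 * y₂, by push_cast; ring⟩
    · exact ⟨3 * y₁, by push_cast; ring⟩
    · exact ⟨3 * x₃, by push_cast; ring⟩
    · simp only [Coord.s]; linarith
    · exact ⟨x₁, by simp⟩
    · exact ⟨y₁, by simp⟩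
    · exact ⟨x₂ - 2 * x₃, by push_cast; ring⟩
    · exact ⟨-y₂, by push_cast; ring⟩⟩

/-- The element `(m, i/3, 2(3-i)/3, 0, 0, 0)` of `𝓑_k`; for `k = 1` these are the letters
`3, 2₂, 2₁, 2`. -/
def thirds {k : ℕ} (m i j : ℕ) (h : m + 1 ≤ k) (hij : i + j = 3) : B k :=
  ⟨⟨m, i / 3, 2 * j / 3, 0, 0, 0⟩, by
    have h' : ((m + 1 : ℕ) : ℚ) ≤ k := by exact_mod_cast h
    have hij' : (i : ℚ) + j = 3 := by exact_mod_cast hij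
    push_cast at h'
    constructor
    · exact ⟨3 * m, by push_cast; ring⟩
    · exact ⟨i, rfl⟩
    · exact ⟨2 * j, by push_cast; ring⟩
    iterate 3 exact ⟨0, by norm_num⟩
    · exact ⟨j, by push_cast; ring⟩
    · simp only [Coord.s]; linarith
    · exact ⟨m, by simp⟩
    · exact ⟨0, by norm_num⟩
    · exact ⟨1 - j, by push_cast; linarith⟩
    · exact ⟨0, by norm_num⟩⟩

theorem u_eq_pt (k : ℕ) : u k = pt k 0 0 0 0 le_rfl := by
  simp [u, pt]

theorem one_eq_pt : one = pt 1 0 0 0 0 le_rfl := u_eq_pt 1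

theorem two_eq_pt : two = pt 0 1 0 0 0 le_rfl := by
  simp [two, pt]

theorem three_eq_pt : three = pt 0 0 1 0 0 le_rfl := by
  simp [three, pt]

theorem thirds_three_zero {k m : ℕ} (h : m + 1 ≤ k) :
    thirds m 3 0 h rfl = pt m 1 0 0 0 h := by
  simp [thirds, pt]

theorem thirds_zero_three {k m : ℕ} (h : m + 1 ≤ k) :
    thirds m 0 3 h rfl = pt m 0 1 0 0 h := by
  simp [thirds, pt]

theorem thirds_two_one : thirds 0 2 1 le_rfl rfl = two₁ := by
  norm_num [thirds, two₁]

theorem thirds_one_two : thirds 0 1 2 le_rfl rfl = two₂ := by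
  norm_num [thirds, two₂]

section Values

variable {k : ℕ}

theorem phi_zero_vac {j : ℕ} (h : j ≤ k) : (crystal k).φ 0 (pt j 0 0 0 0 h) = k - j := by
  have : (0 : ℚ) ≤ j := j.cast_nonneg
  simp only [crystal, Coord.phi, pt, Coord.s, Coord.maxA, Coord.z₁, Coord.z₂, Coord.z₃, Coord.z₄,
    Matrix.cons_val_zero]
  grind

theorem eps_zero_vac {j : ℕ} (h : j ≤ k) : (crystal k).ε 0 (pt j 0 0 0 0 h) = k + j := by
  have : (0 : ℚ) ≤ j := j.cast_nonneg
  simp only [crystal, Coord.eps, pt, Coord.s, Coord.maxA, Coord.z₁, Coord.z₂, Coord.z₃, Coord.z₄,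
    Matrix.cons_val_zero]
  grind

theorem f_zero_vac {j : ℕ} (h : j + 1 ≤ k) :
    (crystal k).f 0 (pt j 0 0 0 0 (by omega)) = some (pt (j + 1) 0 0 0 0 h) := by
  have : (0 : ℚ) ≤ j := j.cast_nonneg
  simp only [crystal, toB_eq_some, Matrix.cons_val_zero]
  rw [Coord.f₀, if_pos]
  · simp [pt]
  · simp only [Coord.F₁, pt, Coord.z₁, Coord.z₂, Coord.z₃, Coord.z₄]
    grind

theorem e_zero_vac {j : ℕ} (h : j + 1 ≤ k) :
    (crystal k).e 0 (pt (j + 1) 0 0 0 0 h) = some (pt j 0 0 0 0 (by omega)) := by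
  have : (0 : ℚ) ≤ j := j.cast_nonneg
  simp only [crystal, toB_eq_some, Matrix.cons_val_zero]
  rw [Coord.e₀, if_pos]
  · simp [pt]
  · simp only [Coord.E₁, pt, Coord.z₁, Coord.z₂, Coord.z₃, Coord.z₄]
    push_cast
    grind

theorem e_zero_empty {j : ℕ} (h : j + 1 ≤ k) :
    (crystal k).e 0 (pt 0 0 0 0 j (by omega)) = some (pt 0 0 0 0 (j + 1) (by omega)) := by
  have : (0 : ℚ) ≤ j := j.cast_nonneg
  simp only [crystal, toB_eq_some, Matrix.cons_val_zero]
  rw [Coord.e₀, if_neg, if_neg, if_neg, if_neg, if_neg]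
  · simp [pt]
  all_goals
    simp only [Coord.E₁, Coord.E₂, Coord.E₃, Coord.E₄, Coord.E₅, pt, Coord.z₁, Coord.z₂, Coord.z₃,
      Coord.z₄]
    grind

theorem f_zero_anti {j : ℕ} (h : j + 1 ≤ k) :
    (crystal k).f 0 (pt 0 0 0 0 (j + 1) (by omega)) = some (pt 0 0 0 0 j (by omega)) := by
  have : (0 : ℚ) ≤ j := j.cast_nonneg
  simp only [crystal, toB_eq_some, Matrix.cons_val_zero]
  rw [Coord.f₀, if_neg, if_neg, if_neg, if_neg, if_neg]
  · simp [pt]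
  all_goals
    simp only [Coord.F₁, Coord.F₂, Coord.F₃, Coord.F₄, Coord.F₅, pt, Coord.z₁, Coord.z₂, Coord.z₃,
      Coord.z₄]
    push_cast
    grind

theorem eps_zero_anti {j : ℕ} (h : j ≤ k) :
    (crystal k).ε 0 (pt 0 0 0 0 j (by omega)) = k - j := by
  have : (0 : ℚ) ≤ j := j.cast_nonneg
  simp only [crystal, Coord.eps, pt, Coord.s, Coord.maxA, Coord.z₁, Coord.z₂, Coord.z₃, Coord.z₄,
    Matrix.cons_val_zero]
  grind

/-- `f̃₀ (0,0,0,0,1,1) = (0,0,0,0,1,0)`. -/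
theorem f_zero_y₂_y₁ (h : 2 ≤ k) :
    (crystal k).f 0 (pt 0 0 0 1 1 h) = some (pt 0 0 0 1 0 (by omega)) := by
  simp only [crystal, toB_eq_some, Matrix.cons_val_zero]
  rw [Coord.f₀, if_neg, if_neg, if_neg, if_neg, if_neg]
  · simp [pt]
  all_goals
    norm_num [Coord.F₁, Coord.F₂, Coord.F₃, Coord.F₄, Coord.F₅, pt, Coord.z₁, Coord.z₂, Coord.z₃,
      Coord.z₄]

theorem f_zero_y₂ (h : 1 ≤ k) :
    (crystal k).f 0 (pt 0 0 0 1 0 h) = some (pt 0 0 1 0 0 h) := by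
  simp only [crystal, toB_eq_some, Matrix.cons_val_zero]
  rw [Coord.f₀, if_neg, if_neg, if_pos]
  · simp [pt]
  all_goals norm_num [Coord.F₁, Coord.F₂, Coord.F₃, pt, Coord.z₁, Coord.z₂, Coord.z₃, Coord.z₄]

theorem e_zero_x₃ (h : 1 ≤ k) :
    (crystal k).e 0 (pt 0 0 1 0 0 h) = some (pt 0 0 0 1 0 h) := by
  simp only [crystal, toB_eq_some, Matrix.cons_val_zero]
  rw [Coord.e₀, if_neg, if_neg, if_pos, if_neg, if_neg]
  · simp [pt]
  all_goals norm_num [Coord.E₁, Coord.E₂, Coord.E₃, pt, Coord.z₁, Coord.z₂, Coord.z₃, Coord.z₄]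

theorem eps_zero_y₂ (h : 1 ≤ k) : (crystal k).ε 0 (pt 0 0 0 1 0 h) = k - 1 := by
  simp only [crystal, Coord.eps, pt, Coord.s, Coord.maxA, Coord.z₁, Coord.z₂, Coord.z₃, Coord.z₄,
    Matrix.cons_val_zero]
  norm_num

theorem f_zero_x₁_x₃ {j : ℕ} (h : j + 2 ≤ k) :
    (crystal k).f 0 (pt j 0 1 0 0 (by omega)) = some (pt (j + 1) 0 1 0 0 (by omega)) := by
  have : (0 : ℚ) ≤ j := j.cast_nonneg
  simp only [crystal, toB_eq_some, Matrix.cons_val_zero]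
  rw [Coord.f₀, if_pos]
  · simp [pt]
  · simp only [Coord.F₁, pt, Coord.z₁, Coord.z₂, Coord.z₃, Coord.z₄]
    grind

theorem eps_zero_x₁_x₃ {j : ℕ} (h : j + 1 ≤ k) :
    (crystal k).ε 0 (pt j 0 1 0 0 (by omega)) = k + j := by
  have : (0 : ℚ) ≤ j := j.cast_nonneg
  simp only [crystal, Coord.eps, pt, Coord.s, Coord.maxA, Coord.z₁, Coord.z₂, Coord.z₃, Coord.z₄,
    Matrix.cons_val_zero]
  push_cast
  grind

theorem eps_zero_nonneg (b : B k) : 0 ≤ (crystal k).ε 0 b := by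
  have := b.2.le
  simp only [crystal, Coord.eps, Coord.maxA, Matrix.cons_val_zero]
  grind

theorem e_one_y₁ {j : ℕ} (h : j + 1 ≤ k) :
    (crystal k).e 1 (pt 0 0 0 0 (j + 1) (by omega)) = some (pt 0 0 0 1 j (by omega)) := by
  simp only [crystal, toB_eq_some, Matrix.cons_val_zero, Matrix.cons_val_one]
  rw [Coord.e₁, if_pos]
  · simp [pt]
  · simp [Coord.z₂, Coord.z₃, pt]

theorem f_one_y₂ (h : 1 ≤ k) :
    (crystal k).f 1 (pt 0 0 0 1 0 h) = some (pt 0 0 0 0 1 h) := by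
  simp only [crystal, toB_eq_some, Matrix.cons_val_zero, Matrix.cons_val_one]
  rw [Coord.f₁, if_neg, if_neg]
  · simp [pt]
  all_goals simp [Coord.z₂, Coord.z₃, pt]

theorem eps_one_y {i j : ℕ} (h : i + j ≤ k) :
    (crystal k).ε 1 (pt 0 0 0 i j (by omega)) = j := by
  have : (0 : ℚ) ≤ i := i.cast_nonneg
  simp only [crystal, Coord.eps, pt, Matrix.cons_val_zero, Matrix.cons_val_one]
  grind

theorem phi_one_x {i j : ℕ} (h : i + j ≤ k) :
    (crystal k).φ 1 (pt i j 0 0 0 (by omega)) = i := by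
  have : (0 : ℚ) ≤ j := j.cast_nonneg
  simp only [crystal, Coord.phi, pt, Matrix.cons_val_zero, Matrix.cons_val_one]
  grind

theorem eps_one_x {i j : ℕ} (h : i + j ≤ k) :
    (crystal k).ε 1 (pt i j 0 0 0 (by omega)) = j := by
  have : (0 : ℚ) ≤ j := j.cast_nonneg
  simp only [crystal, Coord.eps, pt, Matrix.cons_val_zero, Matrix.cons_val_one]
  grind

theorem f_one_x {i j : ℕ} (h : i + 1 + j ≤ k) :
    (crystal k).f 1 (pt (i + 1) j 0 0 0 (by omega)) = some (pt i (j + 1) 0 0 0 (by omega)) := by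
  simp only [crystal, toB_eq_some, Matrix.cons_val_zero, Matrix.cons_val_one]
  rw [Coord.f₁, if_pos]
  · simp [pt]
  · simp [Coord.z₂, Coord.z₃, pt]

variable {m i j : ℕ}

theorem phi_two_thirds (h : m + 1 ≤ k) (hij : i + j = 3) :
    (crystal k).φ 2 (thirds m i j h hij) = i := by
  have : (0 : ℚ) ≤ j := j.cast_nonneg
  simp only [crystal, Coord.phi, thirds, Matrix.cons_val]
  grind

theorem eps_two_thirds (h : m + 1 ≤ k) (hij : i + j = 3) :
    (crystal k).ε 2 (thirds m i j h hij) = j := by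
  have : (0 : ℚ) ≤ j := j.cast_nonneg
  simp only [crystal, Coord.eps, thirds, Matrix.cons_val]
  grind

theorem f_two_thirds (h : m + 1 ≤ k) (hij : i + 1 + j = 3) :
    (crystal k).f 2 (thirds m (i + 1) j h hij) =
      some (thirds m i (j + 1) h (by omega)) := by
  have : (0 : ℚ) ≤ j := j.cast_nonneg
  simp only [crystal, toB_eq_some, Matrix.cons_val]
  rw [Coord.f₂, if_pos, Coord.ext_iff]
  · simp only [thirds, true_and, and_true]
    push_cast
    constructor <;> ring
  · simp only [Coord.z₄, thirds]
    linarith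

theorem e_two_thirds (h : m + 1 ≤ k) (hij : i + (j + 1) = 3) :
    (crystal k).e 2 (thirds m i (j + 1) h hij) =
      some (thirds m (i + 1) j h (by omega)) := by
  have := (isArrow_two k).1 _ _ (f_two_thirds h (i := i) (j := j) (by omega))
  exact this.1

theorem phi_two_vac (h : j ≤ k) : (crystal k).φ 2 (pt j 0 0 0 0 h) = 0 := by
  simp [crystal, Coord.phi, pt, Matrix.cons_val]

theorem eps_two_vac (h : j ≤ k) : (crystal k).ε 2 (pt j 0 0 0 0 h) = 0 := by
  simp [crystal, Coord.eps, pt, Matrix.cons_val]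

end Values

/-! ### The weight argument characterising `u_k` -/

/-- The positive parts cancel in `φ_i - ε_i`. In `2h₁ + h₂` what is subtracted from `2s` has
positive coefficients in every coordinate except `x₁`, so with `s ≤ k` the maximum `2k` is attained
only at `u_k`. -/
theorem Coord.weight_eq (k : ℕ) (b : Coord) : 2 * (b.phi k 1 - b.eps k 1) +
    (b.phi k 2 - b.eps k 2) = 2 * b.s - (b.x₂ + b.x₃ / 2 + 3 / 2 * b.y₃ + 3 * b.y₂ + 4 * b.y₁) := by
  simp only [Coord.phi, Coord.eps, Coord.s, Matrix.cons_val]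
  grind

theorem weight_le {k : ℕ} (b : B k) :
    2 * (crystal k).wt b 1 + (crystal k).wt b 2 ≤ 2 * k := by
  have h := b.1.weight_eq k
  have hle := b.2.le
  have := b.2.nonneg
  simp only [crystal]
  linarith

theorem weight_u (k : ℕ) : 2 * (crystal k).wt (u k) 1 + (crystal k).wt (u k) 2 = 2 * k := by
  have h := (u k).1.weight_eq k
  simp only [crystal]
  rw [h]
  simp [u, Coord.s]

theorem eq_u_of_le_weight {k : ℕ} {b : B k}
    (hb : 2 * (k : ℚ) ≤ 2 * (crystal k).wt b 1 + (crystal k).wt b 2) : b = u k := by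
  have h := b.1.weight_eq k
  have hle := b.2.le
  obtain ⟨h₁, h₂, h₃, h₄, h₅, h₆⟩ := b.2.nonneg
  simp only [crystal] at hb
  rw [h] at hb
  have h₂' : b.1.x₂ = 0 := by linarith
  have h₃' : b.1.x₃ = 0 := by linarith
  have h₄' : b.1.y₃ = 0 := by linarith
  have h₅' : b.1.y₂ = 0 := by linarith
  have h₆' : b.1.y₁ = 0 := by linarith
  simp only [Coord.s] at hle hb
  refine Subtype.ext (Coord.ext ?_ h₂' h₃' h₄' h₅' h₆')
  simp only [u]
  linarith

/-! ### Values of `R` and `H` forced by crystal arrows -/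

section RMatrix

variable {k : ℕ} {R : B k × B 1 ≃ B 1 × B k} {H : B k × B 1 → ℤ}

/-- `R` preserves the weight `2k + 2`, which is the sum of the two maxima; hence both factors of the
image are maximal. -/
theorem IsCombinatorialR.apply_u (hR : IsCombinatorialR k R) : R (u k, one) = (one, u k) := by
  obtain ⟨h₁, -, -⟩ := hR.1 (u k, one) 1
  obtain ⟨h₂, -, -⟩ := hR.1 (u k, one) 2
  simp only [CrystalOps.tensor] at h₁ h₂
  have h₃ := weight_u k
  have h₄ : 2 * (crystal 1).wt one 1 + (crystal 1).wt one 2 = 2 * (1 : ℕ) := weight_u 1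
  have h₅ := weight_le (R (u k, one)).1
  have h₆ := weight_le (R (u k, one)).2
  exact Prod.ext (eq_u_of_le_weight (by linarith)) (eq_u_of_le_weight (by linarith))

theorem IsCombinatorialR.apply_of_f (hR : IsCombinatorialR k R) {i : Fin 3} {x y : B k × B 1}
    {w w' : B 1 × B k} (h : ((crystal k).tensor (crystal 1)).f i x = some y) (hx : R x = w)
    (hw : ((crystal 1).tensor (crystal k)).f i w = some w') : R y = w' := by
  subst hx
  exact Option.some.inj ((hR.2 x y i h).1.symm.trans hw)

/-- Follows an arrow backwards: `f̃_i` is evaluated in the source and `ẽ_i` in the target, so no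
general inversion of 0-arrows is required. -/
theorem IsCombinatorialR.apply_of_e (hR : IsCombinatorialR k R) {i : Fin 3} {x y : B k × B 1}
    {w w' : B 1 × B k} (h : ((crystal k).tensor (crystal 1)).f i y = some x) (hx : R x = w)
    (hw : ((crystal 1).tensor (crystal k)).e i w = some w') : R y = w' := by
  subst hx
  exact Option.some.inj ((hR.2 y x i h).2.symm.trans hw)

theorem IsEnergyFunction.right_right (hH : IsEnergyFunction k R H) {v : B k} {b b' : B 1}
    {c : B 1} {w : B k} (he : (crystal 1).e 0 b = some b')
    (hlt : (crystal k).φ 0 v < (crystal 1).ε 0 b) (hR : R (v, b) = (c, w))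
    (hlt' : (crystal 1).φ 0 c < (crystal k).ε 0 w) : H (v, b') = H (v, b) - 1 :=
  (hH 0 _ _ (tensor_e_right hlt he)).2.1 ⟨rfl, hlt, by rwa [hR]⟩

theorem IsEnergyFunction.left_left (hH : IsEnergyFunction k R H) {v v' : B k} {b : B 1}
    {c : B 1} {w : B k} (he : (crystal k).e 0 v = some v')
    (hle : (crystal 1).ε 0 b ≤ (crystal k).φ 0 v) (hR : R (v, b) = (c, w))
    (hle' : (crystal k).ε 0 w ≤ (crystal 1).φ 0 c) : H (v', b) = H (v, b) + 1 :=
  (hH 0 _ _ (tensor_e_left hle he)).1 ⟨rfl, hle, by rwa [hR]⟩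

theorem IsEnergyFunction.left_right (hH : IsEnergyFunction k R H) {v v' : B k} {b : B 1}
    {c : B 1} {w : B k} (he : (crystal k).e 0 v = some v')
    (hle : (crystal 1).ε 0 b ≤ (crystal k).φ 0 v) (hR : R (v, b) = (c, w))
    (hlt : (crystal 1).φ 0 c < (crystal k).ε 0 w) : H (v', b) = H (v, b) := by
  refine (hH 0 _ _ (tensor_e_left hle he)).2.2 ?_ ?_
  · rintro ⟨-, -, h⟩
    rw [hR] at h
    exact h.not_gt hlt
  · rintro ⟨-, h, -⟩
    exact h.not_ge hle

theorem phi_zero_one : (crystal 1).φ 0 one = 0 := by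
  rw [one_eq_pt, phi_zero_vac]
  simp

/-- `R (u_k ⊗ ∅) = 1 ⊗ (k-1,0,0,0,0,0)` and `H (u_k ⊗ ∅) = -1`, where `∅ = (0,0,0,0,0,0)`. -/
theorem apply_u_empty (hR : IsCombinatorialR k R) (hH : IsEnergyFunction k R H)
    (hH0 : H (u k, one) = 0) {j : ℕ} (hj : j + 1 = k) :
    R (u k, pt 0 0 0 0 0 zero_le_one) = (one, pt j 0 0 0 0 (by omega)) ∧
      H (u k, pt 0 0 0 0 0 zero_le_one) = -1 := by
  have hφ : (crystal k).φ 0 (u k) = 0 := by simp [u_eq_pt, phi_zero_vac]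
  have hε : (crystal k).ε 0 (u k) = 2 * k := by
    rw [u_eq_pt, eps_zero_vac]
    ring
  have hk : (0 : ℚ) < k := by
    rw [← hj]
    positivity
  have hu : u k = pt (j + 1) 0 0 0 0 hj.le := by
    subst hj
    exact u_eq_pt _
  constructor
  · refine hR.apply_of_e (i := 0) ?_ hR.apply_u
      (tensor_e_right (by rw [phi_zero_one, hε]; linarith) ?_)
    · refine tensor_f_right ?_ ?_
      · rw [hφ]
        exact eps_zero_nonneg _
      · rw [one_eq_pt]
        exact f_zero_vac le_rfl
    · rw [hu]
      exact e_zero_vac hj.le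
  · rw [hH.right_right (b := one) _ _ hR.apply_u, hH0]
    · rfl
    · rw [phi_zero_one, hε]
      linarith
    · rw [one_eq_pt]
      exact e_zero_vac le_rfl
    · rw [hφ, one_eq_pt, eps_zero_vac]
      norm_num

/-- The energy of `u_k ⊗ (0,0,0,0,0,1)` is `-2`. -/
theorem energy_u_y₁ (hR : IsCombinatorialR k R) (hH : IsEnergyFunction k R H)
    (hH0 : H (u k, one) = 0) (hk : 1 ≤ k) :
    H (u k, pt 0 0 0 0 1 le_rfl) = -2 := by
  obtain ⟨j, rfl⟩ := Nat.exists_eq_add_of_le' hk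
  obtain ⟨h₁, h₂⟩ := apply_u_empty hR hH hH0 rfl
  rw [hH.right_right _ _ h₁, h₂]
  · rfl
  · rw [phi_zero_one, eps_zero_vac]
    positivity
  · exact e_zero_empty le_rfl
  · rw [u_eq_pt, phi_zero_vac, eps_zero_vac]
    norm_num

/-- The second factor is left as `ẽ₀(k-1,0,0,0,0,0)` because its form depends on `k`:
`(k-2,0,0,0,0,0)` for `k ≥ 2`, but `(0,0,0,0,0,1)` for `k = 1`. -/
theorem apply_u_y₁ (hR : IsCombinatorialR k R) (hH : IsEnergyFunction k R H)
    (hH0 : H (u k, one) = 0) (hk : 1 ≤ k) {w : B k} {j : ℕ} (hj : j + 1 = k)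
    (hw : (crystal k).e 0 (pt j 0 0 0 0 (by omega)) = some w) :
    R (u k, pt 0 0 0 0 1 le_rfl) = (one, w) := by
  obtain ⟨h₁, -⟩ := apply_u_empty hR hH hH0 hj
  refine hR.apply_of_e (i := 0) (tensor_f_right ?_ (f_zero_anti le_rfl)) h₁
    (tensor_e_right ?_ hw)
  · rw [u_eq_pt, phi_zero_vac, eps_zero_anti le_rfl]
    simp
  · rw [phi_zero_one, eps_zero_vac]
    have : (0 : ℚ) < k := by exact_mod_cast hk
    positivity

/-- For `k = 1` the isomorphism `R` is the identity along the path from `u_k ⊗ 1` to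
`u_k ⊗ 2`. -/
theorem apply_u_y₂_of_eq_one {R : B 1 × B 1 ≃ B 1 × B 1} {H : B 1 × B 1 → ℤ}
    (hR : IsCombinatorialR 1 R) (hH : IsEnergyFunction 1 R H) (hH0 : H (u 1, one) = 0) :
    R (u 1, pt 0 0 0 1 0 le_rfl) = (one, pt 0 0 0 1 0 le_rfl) ∧
      H (u 1, pt 0 0 0 1 0 le_rfl) = -2 := by
  have hu : u 1 = pt 1 0 0 0 0 le_rfl := u_eq_pt 1
  have h₁ := apply_u_y₁ hR hH hH0 le_rfl rfl (e_zero_empty le_rfl)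
  have h₂ := energy_u_y₁ hR hH hH0 le_rfl
  have hle : (crystal 1).ε 0 (pt 0 0 0 0 1 le_rfl) ≤ (crystal 1).φ 0 (u 1) := by
    rw [hu, phi_zero_vac, eps_zero_anti le_rfl]
  have he : (crystal 1).e 0 (u 1) = some (pt 0 0 0 0 0 zero_le_one) := by
    rw [hu]
    exact e_zero_vac le_rfl
  have hf : (crystal 1).f 0 (pt 0 0 0 0 0 zero_le_one) = some (u 1) := by
    rw [hu]
    exact f_zero_vac le_rfl
  have hφ : (crystal 1).φ 0 (pt 0 0 0 0 0 zero_le_one) = 1 := by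
    rw [phi_zero_vac]
    norm_num
  have h₃ := hR.apply_of_e (i := 0)
    (tensor_f_left (by rw [hφ, eps_zero_anti le_rfl]; norm_num) hf) h₁ (tensor_e_left hle he)
  -- For `k = 1`, `ẽ₀` acts on the left on both sides, so emptying the carrier raises `H` by 1.
  -- Refilling it, in `h₈`, cancels this.
  have h₄ := hH.left_left he hle h₁ hle
  have hf' : ((crystal 1).tensor (crystal 1)).f 1
      (pt 0 0 0 0 0 zero_le_one, pt 0 0 0 1 0 le_rfl) =
        some (pt 0 0 0 0 0 zero_le_one, pt 0 0 0 0 1 le_rfl) :=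
    tensor_f_right (by rw [phi_one_x (by norm_num), eps_one_y (by norm_num)]) (f_one_y₂ le_rfl)
  have h₅ := hR.apply_of_e hf' h₃ (tensor_e_right
    (by rw [phi_one_x (by norm_num), eps_one_y (by norm_num)]; norm_num) (e_one_y₁ le_rfl))
  have h₆ := hH.eq_of_f (by decide) hf'
  have hε : (crystal 1).ε 0 (pt 0 0 0 1 0 le_rfl) = 0 := by
    rw [eps_zero_y₂]
    norm_num
  have hlt : (crystal 1).ε 0 (pt 0 0 0 1 0 le_rfl) <
      (crystal 1).φ 0 (pt 0 0 0 0 0 zero_le_one) := by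
    rw [hε, hφ]
    norm_num
  have h₇ := hR.apply_of_f (tensor_f_left hlt hf) h₅ (tensor_f_left hlt hf)
  have hle' : (crystal 1).ε 0 (pt 0 0 0 1 0 le_rfl) ≤ (crystal 1).φ 0 (u 1) := by
    rw [hε, hu, phi_zero_vac]
    norm_num
  have h₈ := hH.left_left he hle' h₇ hle'
  exact ⟨h₇, by linarith⟩

/-- In the source `ẽ₀` acts on the carrier because `ε₀(b) = 0`; in the image it acts on the right
because `φ₀(1) = 0 < ε₀(w)`. The sides differ, so `H` does not change. -/
theorem lower_carrier (hR : IsCombinatorialR k R) (hH : IsEnergyFunction k R H) {j : ℕ}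
    (h : j + 1 ≤ k) {b : B 1} {w w' : B k} (hb : (crystal 1).ε 0 b = 0)
    (hRw : R (pt (j + 1) 0 0 0 0 h, b) = (one, w)) (he : (crystal k).e 0 w = some w')
    (hε : 0 < (crystal k).ε 0 w) :
    R (pt j 0 0 0 0 (by omega), b) = (one, w') ∧
      H (pt j 0 0 0 0 (by omega), b) = H (pt (j + 1) 0 0 0 0 h, b) := by
  have h' : (j : ℚ) + 1 ≤ k := by exact_mod_cast h
  rw [← phi_zero_one] at hε
  refine ⟨hR.apply_of_e (i := 0) (tensor_f_left ?_ (f_zero_vac h)) hRw (tensor_e_right hε he),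
    hH.left_right (e_zero_vac h) ?_ hRw hε⟩
  · rw [hb, phi_zero_vac]
    linarith
  · rw [hb, phi_zero_vac]
    push_cast
    linarith

theorem raise_carrier (hR : IsCombinatorialR k R) (hH : IsEnergyFunction k R H) {j : ℕ}
    (h : j + 1 ≤ k) {b : B 1} {w w' : B k} (hb : (crystal 1).ε 0 b = 0)
    (hRw : R (pt j 0 0 0 0 (by omega), b) = (one, w)) (hf : (crystal k).f 0 w = some w')
    (hε : 0 < (crystal k).ε 0 w') :
    R (pt (j + 1) 0 0 0 0 h, b) = (one, w') ∧
      H (pt (j + 1) 0 0 0 0 h, b) = H (pt j 0 0 0 0 (by omega), b) := by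
  have h' : (j : ℚ) + 1 ≤ k := by exact_mod_cast h
  have hR' : R (pt (j + 1) 0 0 0 0 h, b) = (one, w') := by
    refine hR.apply_of_f (tensor_f_left ?_ (f_zero_vac h)) hRw (tensor_f_right ?_ hf)
    · rw [hb, phi_zero_vac]
      linarith
    · rw [phi_zero_one]
      exact eps_zero_nonneg w
  refine ⟨hR', (hH.left_right (e_zero_vac h) ?_ hR' ?_).symm⟩
  · rw [hb, phi_zero_vac]
    push_cast
    linarith
  · rwa [phi_zero_one]

/-- Descends from the full carrier, so the induction is on the amount `d` already removed. -/
theorem apply_vac_y₁ (hR : IsCombinatorialR k R) (hH : IsEnergyFunction k R H)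
    (hH0 : H (u k, one) = 0) (d : ℕ) : ∀ {j : ℕ} (_ : j + 2 + d = k),
    R (pt (j + 2) 0 0 0 0 (by omega), pt 0 0 0 0 1 le_rfl) = (one, pt j 0 0 0 0 (by omega)) ∧
      H (pt (j + 2) 0 0 0 0 (by omega), pt 0 0 0 0 1 le_rfl) = -2 := by
  induction d with
  | zero =>
    rintro j rfl
    have h₁ := apply_u_y₁ hR hH hH0 (by omega) rfl (e_zero_vac (by omega))
    have h₂ := energy_u_y₁ hR hH hH0 (by omega)
    rw [u_eq_pt] at h₁ h₂
    exact ⟨h₁, h₂⟩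
  | succ d ih =>
    intro j hj
    obtain ⟨h₁, h₂⟩ := ih (j := j + 1) (by omega)
    have hε : 0 < (crystal k).ε 0 (pt (j + 1) 0 0 0 0 (by omega)) := by
      rw [eps_zero_vac]
      positivity
    obtain ⟨h₃, h₄⟩ := lower_carrier hR hH (by omega)
      (by rw [eps_zero_anti le_rfl]; norm_num) h₁ (e_zero_vac (by omega)) hε
    exact ⟨h₃, h₄.trans h₂⟩

/-- For a carrier `(j,0,0,0,0,0)` with `j > 0`, `ẽ₁` would act on the carrier, since `φ₁ = j ≥ 1 =
ε₁(0,0,0,0,0,1)`. Emptying it lets `ẽ₁` change the letter. In the image, `ε₁ = 2` beats `φ₁(1) = 1`.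
-/
theorem apply_empty_y₂ (hR : IsCombinatorialR k R) (hH : IsEnergyFunction k R H)
    (hH0 : H (u k, one) = 0) (hk : 2 ≤ k) :
    R (pt 0 0 0 0 0 (by omega), pt 0 0 0 1 0 le_rfl) = (one, pt 0 0 0 1 1 (by omega)) ∧
      H (pt 0 0 0 0 0 (by omega), pt 0 0 0 1 0 le_rfl) = -2 := by
  have hk' : (2 : ℚ) ≤ k := by exact_mod_cast hk
  have hb : (crystal 1).ε 0 (pt 0 0 0 0 1 le_rfl) = 0 := by
    rw [eps_zero_anti le_rfl]
    norm_num
  obtain ⟨h₁, h₂⟩ := apply_vac_y₁ hR hH hH0 (k - 2) (j := 0) (by omega)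
  obtain ⟨h₃, h₄⟩ := lower_carrier hR hH (by omega) hb h₁ (e_zero_empty (by omega)) (by
    rw [eps_zero_vac, Nat.cast_zero]
    linarith)
  obtain ⟨h₅, h₆⟩ := lower_carrier hR hH (by omega) hb h₃ (e_zero_empty (by omega)) (by
    rw [eps_zero_anti (by omega)]
    norm_num
    linarith)
  have hf : ((crystal k).tensor (crystal 1)).f 1
      (pt 0 0 0 0 0 (by omega), pt 0 0 0 1 0 le_rfl) =
        some (pt 0 0 0 0 0 (by omega), pt 0 0 0 0 1 le_rfl) :=
    tensor_f_right (by rw [phi_one_x (by omega), eps_one_y (by norm_num)]) (f_one_y₂ le_rfl)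
  have h₇ := hR.apply_of_e hf h₅ (tensor_e_right
    (by rw [one_eq_pt, phi_one_x (by norm_num), eps_one_y (by omega)]; norm_num)
    (e_one_y₁ (by omega)))
  have h₈ := hH.eq_of_f (by decide) hf
  exact ⟨h₇, by linarith⟩

theorem apply_vac_y₂ (hR : IsCombinatorialR k R) (hH : IsEnergyFunction k R H)
    (hH0 : H (u k, one) = 0) (hk : 2 ≤ k) {j : ℕ} (hj : j + 2 ≤ k) :
    R (pt (j + 2) 0 0 0 0 hj, pt 0 0 0 1 0 le_rfl) = (one, pt j 0 1 0 0 (by omega)) ∧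
      H (pt (j + 2) 0 0 0 0 hj, pt 0 0 0 1 0 le_rfl) = -2 := by
  have hk' : (2 : ℚ) ≤ k := by exact_mod_cast hk
  have hb : (crystal 1).ε 0 (pt 0 0 0 1 0 le_rfl) = 0 := by
    rw [eps_zero_y₂]
    norm_num
  induction j with
  | zero =>
    obtain ⟨h₁, h₂⟩ := apply_empty_y₂ hR hH hH0 hk
    obtain ⟨h₃, h₄⟩ := raise_carrier hR hH (by omega) hb h₁ (f_zero_y₂_y₁ (by omega)) (by
      rw [eps_zero_y₂]
      linarith)
    obtain ⟨h₅, h₆⟩ := raise_carrier hR hH (by omega) hb h₃ (f_zero_y₂ (by omega)) (by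
      rw [eps_zero_x₁_x₃ (by omega), Nat.cast_zero]
      linarith)
    exact ⟨h₅, h₆.trans (h₄.trans h₂)⟩
  | succ j ih =>
    obtain ⟨h₁, h₂⟩ := ih (by omega)
    obtain ⟨h₃, h₄⟩ := raise_carrier hR hH (by omega) hb h₁ (f_zero_x₁_x₃ (by omega)) (by
      rw [eps_zero_x₁_x₃ (by omega)]
      positivity)
    exact ⟨h₃, h₄.trans h₂⟩

theorem apply_u_y₂ (hR : IsCombinatorialR k R) (hH : IsEnergyFunction k R H)
    (hH0 : H (u k, one) = 0) {j : ℕ} (hj : j + 1 = k) :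
    ∃ w, R (u k, pt 0 0 0 1 0 le_rfl) = (one, w) ∧ H (u k, pt 0 0 0 1 0 le_rfl) = -2 ∧
      (crystal k).f 0 w = some (pt j 0 1 0 0 (by omega)) := by
  subst hj
  cases j with
  | zero =>
    obtain ⟨h₁, h₂⟩ := apply_u_y₂_of_eq_one hR hH hH0
    exact ⟨_, h₁, h₂, f_zero_y₂ le_rfl⟩
  | succ j =>
    obtain ⟨h₁, h₂⟩ := apply_vac_y₂ hR hH hH0 (by omega) (j := j) le_rfl
    rw [u_eq_pt]
    exact ⟨_, h₁, h₂, f_zero_x₁_x₃ (by omega)⟩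

theorem apply_u_three (hR : IsCombinatorialR k R) (hH : IsEnergyFunction k R H)
    (hH0 : H (u k, one) = 0) {j : ℕ} (hj : j + 1 = k) :
    R (u k, three) = (one, pt j 0 1 0 0 (by omega)) ∧ H (u k, three) = -1 := by
  obtain ⟨w, h₁, h₂, hw⟩ := apply_u_y₂ hR hH hH0 hj
  have hφ : (crystal k).φ 0 (u k) = 0 := by simp [u_eq_pt, phi_zero_vac]
  have hε : (crystal 1).ε 0 three = 1 := by
    rw [three_eq_pt, eps_zero_x₁_x₃ (by norm_num)]
    norm_num
  have h₃ : R (u k, three) = (one, pt j 0 1 0 0 (by omega)) := by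
    refine hR.apply_of_f (tensor_f_right ?_ ?_) h₁ (tensor_f_right ?_ hw)
    · rw [hφ]
      exact eps_zero_nonneg _
    · rw [three_eq_pt]
      exact f_zero_y₂ le_rfl
    · rw [phi_zero_one]
      exact eps_zero_nonneg _
  -- Read backwards, `ẽ₀` acts on the right on both sides and lowers `H` from its value at `u_k ⊗ 3`
  -- to `-2`.
  have h₄ := hH.right_right (b := three) (b' := pt 0 0 0 1 0 le_rfl)
    (by rw [three_eq_pt]; exact e_zero_x₃ le_rfl) (by rw [hφ, hε]; norm_num) h₃ (by
      rw [phi_zero_one, eps_zero_x₁_x₃ hj.le, ← hj]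
      positivity)
  exact ⟨h₃, by linarith⟩

/-- Climbs the 2-string from 3 back to 2. As `u_k` and 1 have `φ₂ = 0`, `ẽ₂` acts on the right on
both sides. -/
theorem apply_u_thirds (hR : IsCombinatorialR k R) (hH : IsEnergyFunction k R H)
    (hH0 : H (u k, one) = 0) {m : ℕ} (hm : m + 1 = k) (i : ℕ) : ∀ {j : ℕ} (hij : i + j = 3),
    R (u k, thirds 0 i j le_rfl hij) = (one, thirds m i j hm.le hij) ∧
      H (u k, thirds 0 i j le_rfl hij) = -1 := by
  induction i with
  | zero =>
    intro j hij
    obtain rfl : j = 3 := by omega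
    have := apply_u_three hR hH hH0 hm
    rw [three_eq_pt] at this
    simpa only [thirds_zero_three] using this
  | succ i ih =>
    intro j hij
    obtain ⟨h₁, h₂⟩ := ih (j := j + 1) (by omega)
    have hf : ((crystal k).tensor (crystal 1)).f 2
        (u k, thirds 0 (i + 1) j le_rfl hij) =
          some (u k, thirds 0 i (j + 1) le_rfl (by omega)) := by
      refine tensor_f_right ?_ (f_two_thirds le_rfl hij)
      rw [u_eq_pt, phi_two_vac]
      exact eps_two_nonneg _
    refine ⟨hR.apply_of_e hf h₁ (tensor_e_right ?_ (e_two_thirds _ (by omega))), ?_⟩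
    · rw [one_eq_pt, phi_two_vac, eps_two_thirds]
      positivity
    · rw [← hH.eq_of_f (by decide) hf, h₂]

theorem apply_u_two (hR : IsCombinatorialR k R) (hH : IsEnergyFunction k R H)
    (hH0 : H (u k, one) = 0) {m : ℕ} (hm : m + 1 = k) :
    R (u k, two) = (one, pt m 1 0 0 0 (by omega)) ∧ H (u k, two) = -1 := by
  have h := apply_u_thirds hR hH hH0 hm 3 (j := 0) rfl
  rwa [thirds_three_zero, thirds_three_zero, ← two_eq_pt] at h

/-- `R` and `H` on `(i, j, 0, 0, 0, 0) ⊗ 2` for `i + j = k` and `i > 0`. -/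
theorem apply_carrier_two (hR : IsCombinatorialR k R) (hH : IsEnergyFunction k R H)
    (hH0 : H (u k, one) = 0) (j : ℕ) : ∀ {i : ℕ} (h : i + 1 + j = k),
    R (pt (i + 1) j 0 0 0 h.le, two) = (one, pt i (j + 1) 0 0 0 (by omega)) ∧
      H (pt (i + 1) j 0 0 0 h.le, two) = -1 := by
  induction j with
  | zero =>
    rintro i rfl
    have := apply_u_two hR hH hH0 rfl
    rwa [u_eq_pt] at this
  | succ j ih =>
    intro i h
    obtain ⟨h₁, h₂⟩ := ih (i := i + 1) (by omega)
    have hf : ((crystal k).tensor (crystal 1)).f 1 (pt (i + 1 + 1) j 0 0 0 (by omega), two) =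
        some (pt (i + 1) (j + 1) 0 0 0 (by omega), two) := by
      refine tensor_f_left ?_ (f_one_x (by omega))
      rw [two_eq_pt, eps_one_x (by norm_num), phi_one_x (by omega)]
      push_cast
      linarith [(i.cast_nonneg : (0 : ℚ) ≤ i)]
    refine ⟨hR.apply_of_f hf h₁ (tensor_f_right ?_ (f_one_x (by omega))), ?_⟩
    · rw [one_eq_pt, phi_one_x (by norm_num), eps_one_x (by omega)]
      push_cast
      linarith [(j.cast_nonneg : (0 : ℚ) ≤ j)]
    · rw [hH.eq_of_f (by decide) hf, h₂]

/-- `R` and `H` on `(i, j, 0, 0, 0, 0) ⊗ 1` for `i + j = k` and `j > 0`. -/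
theorem apply_carrier_one (hR : IsCombinatorialR k R) (hH : IsEnergyFunction k R H)
    (hH0 : H (u k, one) = 0) (j : ℕ) : ∀ {i : ℕ} (h : i + (j + 1) = k),
    R (pt i (j + 1) 0 0 0 (by omega), one) = (two, pt (i + 1) j 0 0 0 (by omega)) ∧
      H (pt i (j + 1) 0 0 0 (by omega), one) = 0 := by
  have hε : (crystal 1).ε 1 one = 0 := by
    rw [one_eq_pt, eps_one_x (by norm_num)]
    norm_num
  induction j with
  | zero =>
    rintro i rfl
    have hf : ((crystal (i + 1)).tensor (crystal 1)).f 1 (u (i + 1), one) =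
        some (pt i 1 0 0 0 (by omega), one) := by
      rw [u_eq_pt]
      refine tensor_f_left ?_ (f_one_x (by omega))
      rw [hε, phi_one_x (by omega)]
      positivity
    refine ⟨hR.apply_of_f hf hR.apply_u ?_, (hH.eq_of_f (by decide) hf).trans hH0⟩
    rw [u_eq_pt, one_eq_pt, two_eq_pt]
    refine tensor_f_left ?_ (f_one_x (by omega))
    rw [eps_one_x (by omega), phi_one_x (by omega)]
    norm_num
  | succ j ih =>
    intro i h
    obtain ⟨h₁, h₂⟩ := ih (i := i + 1) (by omega)
    have hf : ((crystal k).tensor (crystal 1)).f 1 (pt (i + 1) (j + 1) 0 0 0 (by omega), one) =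
        some (pt i (j + 1 + 1) 0 0 0 (by omega), one) := by
      refine tensor_f_left ?_ (f_one_x (by omega))
      rw [hε, phi_one_x (by omega)]
      positivity
    refine ⟨hR.apply_of_f hf h₁ (tensor_f_right ?_ (f_one_x (by omega))), ?_⟩
    · rw [two_eq_pt, phi_one_x (by norm_num), eps_one_x (by omega)]
      positivity
    · rw [hH.eq_of_f (by decide) hf, h₂]

/-- `R` and `H` on `(0, k, 0, 0, 0, 0) ⊗ 2`. -/
theorem apply_full_carrier_two (hR : IsCombinatorialR k R) (hH : IsEnergyFunction k R H)
    (hH0 : H (u k, one) = 0) (hk : 1 ≤ k) :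
    R (pt 0 k 0 0 0 (by omega), two) = (two, pt 0 k 0 0 0 (by omega)) ∧
      H (pt 0 k 0 0 0 (by omega), two) = 0 := by
  obtain ⟨j, rfl⟩ := Nat.exists_eq_add_of_le' hk
  obtain ⟨h₁, h₂⟩ := apply_carrier_one hR hH hH0 j (i := 0) (by omega)
  have hf : ((crystal (j + 1)).tensor (crystal 1)).f 1 (pt 0 (j + 1) 0 0 0 (by omega), one) =
      some (pt 0 (j + 1) 0 0 0 (by omega), two) := by
    rw [one_eq_pt, two_eq_pt]
    refine tensor_f_right ?_ (f_one_x (by omega))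
    rw [phi_one_x (by omega), eps_one_x (by omega)]
  refine ⟨hR.apply_of_f hf h₁ (tensor_f_right ?_ (f_one_x (by omega))), ?_⟩
  · rw [two_eq_pt, phi_one_x (by norm_num), eps_one_x (by omega)]
    positivity
  · rw [hH.eq_of_f (by decide) hf, h₂]

end RMatrix

/-! ### Absorbing and releasing the soliton -/

theorem Word.length_toList {n : ℕ} (p : Word n) : p.toList.length = n := by
  induction n with
  | zero => rfl
  | succ n ih => exact congrArg (· + 1) (ih p.2)

theorem Word.toList_injective {n : ℕ} : Function.Injective (Word.toList (n := n)) := by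
  induction n with
  | zero => exact fun _ _ _ => rfl
  | succ n ih =>
    intro p q h
    obtain ⟨h₁, h₂⟩ := List.cons.inj h
    exact Prod.ext h₁ (ih h₂)

section Row

variable {k : ℕ} {R : B k × B 1 ≃ B 1 × B k} {H : B k × B 1 → ℤ}

theorem pt_congr {k i i' j j' : ℕ} {h : i + j + 0 + 0 + 0 ≤ k} (hi : i = i') (hj : j = j') :
    (pt i j 0 0 0 h : B k) = pt i' j' 0 0 0 (hi ▸ hj ▸ h) := by
  subst hi hj
  rfl

theorem row_append (p q : List (B 1)) (v : B k) : row R v (p ++ q) =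
    ((row R v p).1 ++ (row R (row R v p).2 q).1, (row R (row R v p).2 q).2) := by
  induction p generalizing v with
  | nil => rfl
  | cons b p ih => simp [row, ih]

theorem rowSum_append (p q : List (B 1)) (v : B k) : rowSum R H v (p ++ q) =
    rowSum R H v p + rowSum R H (row R v p).2 q := by
  induction p generalizing v with
  | nil => simp [row, rowSum]
  | cons b p ih => simp [row, rowSum, ih, add_assoc]

theorem row_ones (hR : IsCombinatorialR k R) (n : ℕ) :
    row R (u k) (List.replicate n one) = (List.replicate n one, u k) := by
  induction n with
  | zero => rfl
  | succ n ih => simp [List.replicate_succ, row, hR.apply_u, ih]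

theorem rowSum_ones (hR : IsCombinatorialR k R) (hH0 : H (u k, one) = 0) (n : ℕ) :
    rowSum R H (u k) (List.replicate n one) = 0 := by
  induction n with
  | zero => rfl
  | succ n ih => simp [List.replicate_succ, rowSum, hR.apply_u, ih, hH0]

theorem row_twos_of_le (hR : IsCombinatorialR k R) (hH : IsEnergyFunction k R H)
    (hH0 : H (u k, one) = 0) (n : ℕ) : ∀ {i j : ℕ} (h : i + n + j = k),
    row R (pt (i + n) j 0 0 0 h.le) (List.replicate n two) =
        (List.replicate n one, pt i (j + n) 0 0 0 (by omega)) ∧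
      rowSum R H (pt (i + n) j 0 0 0 h.le) (List.replicate n two) = -n := by
  induction n with
  | zero => exact fun _ => ⟨rfl, rfl⟩
  | succ n ih =>
    intro i j h
    obtain ⟨h₁, h₂⟩ := apply_carrier_two hR hH hH0 j (i := i + n) (by omega)
    obtain ⟨h₃, h₄⟩ := ih (i := i) (j := j + 1) (by omega)
    have h₅ : (pt i (j + 1 + n) 0 0 0 (by omega) : B k) = pt i (j + (n + 1)) 0 0 0 (by omega) :=
      pt_congr (by omega) (by omega)
    rw [h₅] at h₃
    simp only [List.replicate_succ, row, rowSum, ← add_assoc i n 1, h₁, h₂, h₃, h₄, true_and]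
    push_cast
    ring

theorem row_twos_of_full (hR : IsCombinatorialR k R) (hH : IsEnergyFunction k R H)
    (hH0 : H (u k, one) = 0) (hk : 1 ≤ k) (n : ℕ) :
    row R (pt 0 k 0 0 0 (by omega)) (List.replicate n two) =
        (List.replicate n two, pt 0 k 0 0 0 (by omega)) ∧
      rowSum R H (pt 0 k 0 0 0 (by omega)) (List.replicate n two) = 0 := by
  obtain ⟨h₁, h₂⟩ := apply_full_carrier_two hR hH hH0 hk
  induction n with
  | zero => exact ⟨rfl, rfl⟩
  | succ n ih => simp [List.replicate_succ, row, rowSum, h₁, h₂, ih]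

theorem row_ones_of_carrier (hR : IsCombinatorialR k R) (hH : IsEnergyFunction k R H)
    (hH0 : H (u k, one) = 0) (n : ℕ) : ∀ {i j : ℕ} (h : i + (j + n) = k),
    row R (pt i (j + n) 0 0 0 (by omega)) (List.replicate n one) =
        (List.replicate n two, pt (i + n) j 0 0 0 (by omega)) ∧
      rowSum R H (pt i (j + n) 0 0 0 (by omega)) (List.replicate n one) = 0 := by
  induction n with
  | zero => exact fun _ => ⟨rfl, rfl⟩
  | succ n ih =>
    intro i j h
    obtain ⟨h₁, h₂⟩ := apply_carrier_one hR hH hH0 (j + n) (i := i) (by omega)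
    obtain ⟨h₃, h₄⟩ := ih (i := i + 1) (j := j) (by omega)
    have h₅ : (pt (i + 1 + n) j 0 0 0 (by omega) : B k) = pt (i + (n + 1)) j 0 0 0 (by omega) :=
      pt_congr (by omega) (by omega)
    rw [h₅] at h₃
    simp [List.replicate_succ, row, rowSum, ← add_assoc j n 1, h₁, h₂, h₃, h₄]

theorem row_twos (hR : IsCombinatorialR k R) (hH : IsEnergyFunction k R H)
    (hH0 : H (u k, one) = 0) (hk : 1 ≤ k) (l : ℕ) {i j m : ℕ} (hi : i + m = k) (hj : m + j = l)
    (hm : m = min k l) :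
    row R (u k) (List.replicate l two) =
        (List.replicate m one ++ List.replicate j two, pt i m 0 0 0 (by omega)) ∧
      rowSum R H (u k) (List.replicate l two) = -m := by
  subst hi hj
  obtain ⟨h₁, h₂⟩ := row_twos_of_le hR hH hH0 m (i := i) (j := 0) (by omega)
  have h₀ : (pt i (0 + m) 0 0 0 (by omega) : B (i + m)) = pt i m 0 0 0 (by omega) :=
    pt_congr rfl (by omega)
  rw [← u_eq_pt] at h₁ h₂
  rw [h₀] at h₁
  rw [List.replicate_add, row_append, rowSum_append, h₁, h₂]
  -- As `m = min k l`, either all 2's have been absorbed (`j = 0`) or the carrier is full (`i = 0`).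
  obtain rfl | rfl : j = 0 ∨ i = 0 := by omega
  · simp [row, rowSum]
  · obtain ⟨h₃, h₄⟩ := row_twos_of_full hR hH hH0 hk j
    have h₅ : (pt 0 (0 + m) 0 0 0 (by omega) : B (0 + m)) = pt 0 m 0 0 0 (by omega) := h₀
    rw [h₅] at h₃ h₄
    simp [h₃, h₄]

/-- The time evolution of the one-soliton state with soliton `2^{⊗ l}`. -/
theorem soliton_twos (hR : IsCombinatorialR k R) (hH : IsEnergyFunction k R H)
    (hH0 : H (u k, one) = 0) (hk : 1 ≤ k) (l a r : ℕ) :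
    rowSum R H (u k) (embed a (List.replicate l two) r) = -(min k l : ℕ) ∧
      (min k l ≤ r → row R (u k) (embed a (List.replicate l two) r) =
        (embed (a + min k l) (List.replicate l two) (r - min k l), u k)) := by
  obtain ⟨m, hm⟩ : ∃ m, m = min k l := ⟨_, rfl⟩
  rw [← hm]
  obtain ⟨i, hi⟩ := Nat.exists_eq_add_of_le' (hm.trans_le (min_le_left k l))
  obtain ⟨j, hj⟩ := Nat.exists_eq_add_of_le (hm.trans_le (min_le_right k l))
  obtain ⟨h₁, h₂⟩ := row_twos hR hH hH0 hk l hi.symm hj.symm hm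
  have hdrain := row_ones_of_carrier hR hH hH0 m (i := i) (j := 0) (by omega)
  have h₀ : (pt i (0 + m) 0 0 0 (by omega) : B k) = pt i m 0 0 0 (by omega) :=
    pt_congr rfl (by omega)
  have h₀' : (pt (i + m) 0 0 0 0 (by omega) : B k) = u k := by
    subst hi
    exact (u_eq_pt _).symm
  rw [h₀, h₀'] at hdrain
  obtain ⟨h₃, h₄⟩ := hdrain
  constructor
  · rw [embed, rowSum_append, rowSum_append, row_append, row_ones hR, rowSum_ones hR hH0]
    simp only [h₁, h₂]
    -- The energy claim allows any `r`: trailing 1's contribute 0 even when there are too few to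
    -- empty the carrier.
    suffices h : rowSum R H (pt i m 0 0 0 (by omega)) (List.replicate r one) = 0 by
      rw [h]
      ring
    rcases le_total r m with hr | hr
    · obtain ⟨t, rfl⟩ := Nat.exists_eq_add_of_le' hr
      exact (row_ones_of_carrier hR hH hH0 r (i := i) (j := t) (by omega)).2
    · obtain ⟨t, rfl⟩ := Nat.exists_eq_add_of_le hr
      rw [List.replicate_add, rowSum_append, h₃, h₄, rowSum_ones hR hH0, zero_add]
  · intro hr
    obtain ⟨t, rfl⟩ := Nat.exists_eq_add_of_le hr
    rw [embed, embed, row_append, row_append, row_ones hR]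
    simp only [h₁]
    rw [List.replicate_add m t, row_append, h₃]
    simp only [row_ones hR, Nat.add_sub_cancel_left, Prod.mk.injEq, and_true]
    rw [List.replicate_add a m, hj, Nat.add_comm m j, List.replicate_add j m]
    simp only [List.append_assoc]

/-- The invariance of the claim under `f̃₂`. -/
theorem soliton_of_isStep (hR : IsCombinatorialR k R) (hH : IsEnergyFunction k R H)
    {s s' : List (B 1)} (hs : ∀ a r, IsStep (embed a s r) (embed a s' r)) {d : ℕ}
    (h : ∀ a r, rowSum R H (u k) (embed a s r) = -d ∧
      (d ≤ r → row R (u k) (embed a s r) = (embed (a + d) s (r - d), u k))) (a r : ℕ) :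
    rowSum R H (u k) (embed a s' r) = -d ∧
      (d ≤ r → row R (u k) (embed a s' r) = (embed (a + d) s' (r - d), u k)) := by
  obtain ⟨n, x, y, hx, hy, hf⟩ := hs a r
  obtain ⟨h₁, h₂⟩ := h a r
  have hφ : (crystal k).φ 2 (u k) = 0 := by rw [u_eq_pt, phi_two_vac]
  have hxy : ((crystal k).tensor (word n)).f 2 (u k, x) = some (u k, y) :=
    tensor_f_right (hφ.trans_le (word_eps_two_nonneg x)) hf
  rw [← hx] at h₁ h₂
  rw [← hy, hH.rowSum_eq_of_f_two hR hxy]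
  refine ⟨h₁, fun hr => ?_⟩
  have h₃ := (hR.isHom_wordRow n).2 _ _ hxy
  have h₂ := h₂ hr
  rw [row_toList] at h₂ ⊢
  rcases hX : wordRow R n (u k, x) with ⟨X, v⟩
  generalize wordRow R n (u k, y) = Z at h₃ ⊢
  obtain ⟨Y, w⟩ := Z
  rw [hX] at h₂ h₃
  obtain ⟨hXs, hv⟩ := Prod.ext_iff.1 h₂
  obtain rfl : v = u k := hv
  replace hXs : X.toList = embed (a + d) s (r - d) := hXs
  -- The same step is available on the shifted state, so applying `f̃₂` to the image yields the
  -- shift of the new soliton.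
  obtain ⟨n', x', y', hx', hy', hf'⟩ := hs (a + d) (r - d)
  have hlen := congrArg List.length (hx'.trans hXs.symm)
  simp only [Word.length_toList] at hlen
  subst hlen
  obtain rfl := Word.toList_injective (hx'.trans hXs.symm)
  obtain ⟨-, hY, hw⟩ | ⟨-, hw, -⟩ := tensor_f_eq_some h₃
  · rw [hf'] at hY
    rw [← hy', Option.some.inj hY]
    exact congrArg (Prod.mk Y.toList) hw
  · have h₄ := ((isArrow_two k).1 _ _ hw).2.1
    have h₅ := phi_two_nonneg w
    linarith

end Row

/-! ### Generating all solitons by `f̃₂` -/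

theorem IsStep.soliton {i j : ℕ} (hij : i + 1 + j = 3) (m n a r : ℕ) :
    IsStep
      (embed a (List.replicate m three ++
        thirds 0 (i + 1) j le_rfl hij :: List.replicate n two) r)
      (embed a (List.replicate m three ++
        thirds 0 i (j + 1) le_rfl (by omega) :: List.replicate n two) r) := by
  simp only [embed, List.append_assoc, List.cons_append]
  have h₁ : (crystal 1).φ 2 one = 0 := by rw [one_eq_pt, phi_two_vac]
  have h₂ : (crystal 1).φ 2 three = 0 := by
    rw [three_eq_pt, ← thirds_zero_three, phi_two_thirds]
    norm_num
  have h₃ : (crystal 1).ε 2 two = 0 := by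
    rw [two_eq_pt, ← thirds_three_zero, eps_two_thirds]
    norm_num
  have h₄ : (crystal 1).ε 2 one = 0 := by rw [one_eq_pt, eps_two_vac]
  refine ((IsStep.head (f_two_thirds le_rfl hij) ?_ ?_).replicate_append h₂ m).replicate_append h₁ a
  · rw [phi_two_thirds]
    positivity
  · intro c hc
    rcases List.mem_append.1 hc with hc | hc <;> rw [List.eq_of_mem_replicate hc] <;> assumption

/-- All the solitons of length `l` are obtained from `2^{⊗ l}` by applying `f̃₂`. -/
theorem IsSoliton.induction {P : List (B 1) → Prop} {l : ℕ} (h₀ : P (List.replicate l two))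
    (hP : ∀ s s', (∀ a r, IsStep (embed a s r) (embed a s' r)) → P s → P s')
    {s : List (B 1)} (hs : IsSoliton l s) : P s := by
  have key : ∀ m n, m + n = l → P (List.replicate m three ++ List.replicate n two) ∧
      ∀ n', n = n' + 1 → ∀ i j (hij : i + j = 3),
        P (List.replicate m three ++ thirds 0 i j le_rfl hij :: List.replicate n' two) := by
    have hthirds : ∀ m n, P (List.replicate m three ++ List.replicate (n + 1) two) →
        ∀ j i (hij : i + j = 3),
          P (List.replicate m three ++ thirds 0 i j le_rfl hij :: List.replicate n two) := by
      intro m n h j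
      induction j with
      | zero =>
        intro i hij
        obtain rfl : i = 3 := hij
        rwa [thirds_three_zero, ← two_eq_pt, ← List.replicate_succ]
      | succ j ih =>
        intro i hij
        exact hP _ _ (IsStep.soliton (by omega) m n) (ih (i + 1) (by omega))
    intro m
    induction m with
    | zero =>
      rintro n rfl
      rw [zero_add] at h₀
      refine ⟨by simpa using h₀, ?_⟩
      rintro n' rfl i j hij
      exact hthirds 0 n' (by simpa using h₀) j i hij
    | succ m ih =>
      intro n hn
      -- After three steps the letter at position `m + 1` has become 3, which lengthens the block of
      -- 3's by one.
      have h := (ih (n + 1) (by omega)).2 n rfl 0 3 rfl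
      rw [thirds_zero_three, ← three_eq_pt] at h
      have h' : P (List.replicate (m + 1) three ++ List.replicate n two) := by
        rw [List.replicate_succ']
        simpa using h
      refine ⟨h', ?_⟩
      rintro n' rfl i j hij
      exact hthirds (m + 1) n' h' j i hij
  obtain ⟨m, n, ⟨h, rfl⟩ | ⟨h, rfl⟩ | ⟨h, rfl⟩⟩ := hs
  · exact (key m n h).1
  · rw [← thirds_two_one]
    exact (key m (n + 1) (by omega)).2 n rfl 2 1 rfl
  · rw [← thirds_one_two]
    exact (key m (n + 1) (by omega)).2 n rfl 1 2 rfl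

end G2SCA

theorem proposition11 (k l : ℕ) (hk : 1 ≤ k) (hl : 1 ≤ l)
    (R : G2SCA.B k × G2SCA.B 1 ≃ G2SCA.B 1 × G2SCA.B k) (hR : G2SCA.IsCombinatorialR k R)
    (H : G2SCA.B k × G2SCA.B 1 → ℤ) (hH : G2SCA.IsEnergyFunction k R H)
    (hH0 : H (G2SCA.u k, G2SCA.one) = 0)
    (s : List (G2SCA.B 1)) (hs : G2SCA.IsSoliton l s) (a r : ℕ) :
    G2SCA.stateEnergy R H (G2SCA.embed a s r) = (min k l : ℕ) ∧
    (min k l ≤ r → G2SCA.IsTimeEvolution R (G2SCA.embed a s r)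
      (G2SCA.embed (a + min k l) s (r - min k l))) := by

  have h := G2SCA.IsSoliton.induction
    (P := fun s => ∀ a r, G2SCA.rowSum R H (G2SCA.u k) (G2SCA.embed a s r) = -(min k l : ℕ) ∧
      (min k l ≤ r → G2SCA.row R (G2SCA.u k) (G2SCA.embed a s r) =
        (G2SCA.embed (a + min k l) s (r - min k l), G2SCA.u k)))
    (G2SCA.soliton_twos hR hH hH0 hk l)
    (fun _ _ hstep h => G2SCA.soliton_of_isStep hR hH hstep h) hs a r
  exact ⟨by rw [G2SCA.stateEnergy, h.1, neg_neg], h.2⟩
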